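/- Let $A$ be a finite-dimensional Hopf algebra over a field $\Bbbk$, with coproduct $\Delta$, counit $\epsilon$ and antipode $S$. Let $A$-mod be the category of finite-dimensional left $A$-modules, with the tensor product over $\Bbbk$ on which $A$ acts through $\Delta$ and the unit object $\mathbb 1=\Bbbk$ on which $A$ acts through $\epsilon$. For a module $V$ let $V^*=\mathrm{Hom}_\Bbbk(V,\Bbbk)$ with $(a\varphi)(v)=\varphi(S(a)v)$. Suppose that $A$ is *pivotal*: a group-like element $g\in A$ with $S^2(x)=gxg^{-1}$ for all $x\in A$ is given. Then $A$-mod is a pivotal category with the duality morphisms $\overleftarrow{\mathrm{ev}}_V(\varphi\otimes v)=\varphi(v)$, $\overleftarrow{\mathrm{coev}}_V(1)=\sum_i e_i\otimes e^i$, $\overrightarrow{\mathrm{ev}}_V(v\otimes\varphi)=\varphi(gv)$, $\overrightarrow{\mathrm{coev}}_V(1)=\sum_i e^i\otimes g^{-1}e_i$, where $(e_i)$ is a basis of $V$ and $(e^i)$ is the dual basis. Suppose that $A$ is *unimodular*: $S(\Lambda)=\Lambda$ for every left cointegral $\Lambda$ (an element $\Lambda\in A$ with $x\Lambda=\epsilon(x)\Lambda$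 for all $x\in A$). An *ideal* of $A$-mod is a full subcategory closed under retracts and under tensor products with arbitrary objects on either side. A *left* (resp. *right*) *m-trace* on an ideal $\mathcal I$ is a family of linear forms $\mathsf t_V:\mathrm{End}(V)\to\Bbbk$, $V\in\mathcal I$, such that $\mathsf t_V(pq)=\mathsf t_U(qp)$ for all $U,V\in\mathcal I$, $q:V\to U$, $p:U\to V$, and such that, for all $U\in\mathcal I$, all objects $W$ and all $f\in\mathrm{End}(W\otimes U)$ (resp. $f\in\mathrm{End}(U\otimes W)$), $$\mathsf t_{W\otimes U}(f)=\mathsf t_U\big((\overleftarrow{\mathrm{ev}}_W\otimes \mathrm{Id}_U)(\mathrm{Id}_{W^*}\otimes f)(\overrightarrow{\mathrm{coev}}_W\otimes \mathrm{Id}_U)\big)$$ $$\text{(resp. } \mathsf t_{U\otimes W}(f)=\mathsf t_U\big((\mathrm{Id}_U\otimes\overrightarrow{\mathrm{ev}}_W)(f\otimes \mathrm{Id}_{W^*})(\mathrm{Id}_U\otimes\overleftarrow{\mathrm{coev}}_W)\big)\text{)}.$$ An *m-trace* is a left m-trace that is also a right m-trace. It is *non-degenerate* if for every $P\in\mathcal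 I$ the pairing $\mathrm{Hom}(\mathbb 1,P)\times \mathrm{Hom}(P,\mathbb 1)\to\Bbbk$, $(x,y)\mapsto\mathsf t_P(xy)$, is non-degenerate; then $\Lambda_P=\sum_i x_iy_i\in\mathrm{End}(P)$, where $(x_i)$ is a basis of $\mathrm{Hom}(\mathbb 1,P)$ and $(y_i)$ is the dual basis of $\mathrm{Hom}(P,\mathbb 1)$. A *generator* of $\mathcal I$ is an object $G\in\mathcal I$ such that for every $P\in\mathcal I$ the morphism $\mathrm{Id}_P$ is a finite sum $\sum_j f_jg_j$ with $f_j:G\to P$ and $g_j:P\to G$. A *chromatic morphism* for $G\in\mathcal I$ (with respect to a non-degenerate m-trace) is a morphism $\tilde d:G\otimes G\to G\otimes G$ with $$(\mathrm{Id}_G\otimes\overleftarrow{\mathrm{ev}}_G\otimes\mathrm{Id}_G)\circ(\Lambda_{G\otimes G^*}\otimes\tilde d)\circ(\mathrm{Id}_G\otimes\overrightarrow{\mathrm{coev}}_G\otimes\mathrm{Id}_G)=\mathrm{Id}_{G\otimes G}.$$ Let $\mathsf{Proj}$ be the full subcategory of projective objects of $A$-mod, and suppose finally that $A$ (with $g$)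 is *unibalanced*: every left m-trace on $\mathsf{Proj}$ is also a right m-trace. Then: 1. $\mathsf{Proj}$ is an ideal of $A$-mod, and the left regular module $A$ is a generator of $\mathsf{Proj}$. 2. There are a right integral $\lambda$ of $A$ (a linear form $\lambda:A\to\Bbbk$ with $(\lambda\otimes\mathrm{Id}_A)\Delta(x)=\lambda(x)1_A$ for all $x\in A$) and a left cointegral $\Lambda\in A$ such that $\lambda(\Lambda)=1$. 3. Let $\lambda,\Lambda$ be any such pair, and let $f_\Lambda:\mathbb 1\to A$ be the morphism carrying $1$ to $\Lambda$. There is a non-degenerate m-trace $\mathsf t$ on $\mathsf{Proj}$ with $\mathsf t_A(f_\Lambda\circ\epsilon)=1$. 4. With respect to every $\mathsf t$ as in 3, the morphism $$\tilde d=(\overrightarrow{\mathrm{ev}}_A\otimes\mathrm{Id}_{A\otimes A})\circ(\mathrm{Id}_A\otimes f_{\lambda}\otimes\mathrm{Id}_A)\circ(\mathrm{Id}_A\otimes\Delta):A\otimes A\to A\otimes A,$$ where $f_{\lambda}:A\to A^*\otimes A$ is the morphism of $A$-modules carrying $1_A$ to $\lambda\otimes 1_A$, is a chromatic morphism for $A$.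 -/

import Mathlib

open CategoryTheory MonoidalCategory TensorProduct

universe w v u

/-! ### Pivotal categories, ideals, modified traces, generators, chromatic morphisms -/

section General

variable {C : Type u} [Category.{v} C] [MonoidalCategory C]

/-- The morphism `X ⟶ D` obtained from `b : X ⊗ V ⟶ 𝟙_ C` with the help of `c : 𝟙_ C ⟶ V ⊗ D`. -/
def leftMate {X V D : C} (c : 𝟙_ C ⟶ V ⊗ D) (b : X ⊗ V ⟶ 𝟙_ C) : X ⟶ D :=
  (ρ_ X).inv ≫ X ◁ c ≫ (α_ X V D).inv ≫ b ▷ D ≫ (λ_ D).hom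

/-- The morphism `X ⟶ D` obtained from `b : V ⊗ X ⟶ 𝟙_ C` with the help of `c : 𝟙_ C ⟶ D ⊗ V`. -/
def rightMate {X V D : C} (c : 𝟙_ C ⟶ D ⊗ V) (b : V ⊗ X ⟶ 𝟙_ C) : X ⟶ D :=
  (λ_ X).inv ≫ c ▷ X ≫ (α_ D V X).hom ≫ D ◁ b ≫ (ρ_ D).hom

/-- The nested pairing `(Y ⊗ X) ⊗ (V ⊗ W) ⟶ 𝟙_ C` of two pairings `X ⊗ V ⟶ 𝟙_ C` and
`Y ⊗ W ⟶ 𝟙_ C`. -/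
def nestedPairing {X Y V W : C} (b : X ⊗ V ⟶ 𝟙_ C) (c : Y ⊗ W ⟶ 𝟙_ C) :
    (Y ⊗ X) ⊗ (V ⊗ W) ⟶ 𝟙_ C :=
  (α_ Y X (V ⊗ W)).hom ≫ Y ◁ ((α_ X V W).inv ≫ b ▷ W ≫ (λ_ W).hom) ≫ c

variable (C) in
/-- A pivotal structure on a monoidal category: every object has a dual, which is a left and a right
dual by means of the morphisms `coevL`, `evL` (written with arrows pointing to the left) and
`coevR`, `evR` (arrows pointing to the right), and the resulting left and right duality functors
coincide as monoidal functors. -/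
structure PivotalStructure where
  dual : C → C
  coevL (V : C) : 𝟙_ C ⟶ V ⊗ dual V
  evL (V : C) : dual V ⊗ V ⟶ 𝟙_ C
  coevR (V : C) : 𝟙_ C ⟶ dual V ⊗ V
  evR (V : C) : V ⊗ dual V ⟶ 𝟙_ C
  coevL_evL (V : C) :
    dual V ◁ coevL V ≫ (α_ _ _ _).inv ≫ evL V ▷ dual V = (ρ_ (dual V)).hom ≫ (λ_ (dual V)).inv
  evL_coevL (V : C) :
    coevL V ▷ V ≫ (α_ _ _ _).hom ≫ V ◁ evL V = (λ_ V).hom ≫ (ρ_ V).inv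
  coevR_evR (V : C) :
    V ◁ coevR V ≫ (α_ _ _ _).inv ≫ evR V ▷ V = (ρ_ V).hom ≫ (λ_ V).inv
  evR_coevR (V : C) :
    coevR V ▷ dual V ≫ (α_ _ _ _).hom ≫ dual V ◁ evR V = (λ_ (dual V)).hom ≫ (ρ_ (dual V)).inv
  transpose_eq {V W : C} (f : V ⟶ W) :
    leftMate (coevL V) (dual W ◁ f ≫ evL W) = rightMate (coevR V) (f ▷ dual W ≫ evR W)
  tensor_eq (V W : C) :
    leftMate (coevL (V ⊗ W)) (nestedPairing (evL V) (evL W)) =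
      rightMate (coevR (V ⊗ W)) (nestedPairing (evR W) (evR V))

/-- A full subcategory (given by its objects) is an ideal if it is closed under tensor products with
arbitrary objects on both sides and under retracts. -/
structure IsTensorIdeal (I : ObjectProperty C) : Prop where
  tensor_right (V W : C) : I V → I (V ⊗ W)
  tensor_left (V W : C) : I V → I (W ⊗ V)
  retract (V W : C) (f : W ⟶ V) (g : V ⟶ W) : f ≫ g = 𝟙 W → I V → I W

/-- The partial trace over `W` (on the right) of an endomorphism of `U ⊗ W`. -/
def rightPartialTrace (D : PivotalStructure C) {U W : C} (f : U ⊗ W ⟶ U ⊗ W) : U ⟶ U :=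
  (ρ_ U).inv ≫ U ◁ D.coevL W ≫ (α_ U W (D.dual W)).inv ≫ f ▷ D.dual W ≫
    (α_ U W (D.dual W)).hom ≫ U ◁ D.evR W ≫ (ρ_ U).hom

/-- The partial trace over `W` (on the left) of an endomorphism of `W ⊗ U`. -/
def leftPartialTrace (D : PivotalStructure C) {U W : C} (f : W ⊗ U ⟶ W ⊗ U) : U ⟶ U :=
  (λ_ U).inv ≫ D.coevR W ▷ U ≫ (α_ (D.dual W) W U).hom ≫ D.dual W ◁ f ≫
    (α_ (D.dual W) W U).inv ≫ D.evL W ▷ U ≫ (λ_ U).hom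

variable (k : Type w) [Field k] [Preadditive C] [Linear k C]

/-- A family of linear forms on `End V`, for the objects `V` of `I`. -/
abbrev TraceFamily (I : ObjectProperty C) : Type _ :=
  ∀ V : C, I V → ((V ⟶ V) →ₗ[k] k)

variable {k} {I : ObjectProperty C}

def TraceFamily.IsCyclic (t : TraceFamily k I) : Prop :=
  ∀ (U V : C) (hU : I U) (hV : I V) (f : V ⟶ U) (g : U ⟶ V), t V hV (f ≫ g) = t U hU (g ≫ f)

/-- A left modified trace on `I`. The membership of `W ⊗ U` in `I` is automatic
if `I` is an ideal. -/
structure TraceFamily.IsLeftMTrace (t : TraceFamily k I) (D : PivotalStructure C) : Prop where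
  cyclic : t.IsCyclic
  left_partial (U W : C) (hU : I U) (hWU : I (W ⊗ U)) (f : W ⊗ U ⟶ W ⊗ U) :
    t (W ⊗ U) hWU f = t U hU (leftPartialTrace D f)

/-- A right modified trace on `I`. The membership of `U ⊗ W` in `I` is automatic
if `I` is an ideal. -/
structure TraceFamily.IsRightMTrace (t : TraceFamily k I) (D : PivotalStructure C) : Prop where
  cyclic : t.IsCyclic
  right_partial (U W : C) (hU : I U) (hUW : I (U ⊗ W)) (f : U ⊗ W ⟶ U ⊗ W) :
    t (U ⊗ W) hUW f = t U hU (rightPartialTrace D f)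

/-- A (two-sided) modified trace: cyclicity and both partial trace properties. -/
def TraceFamily.IsMTrace (t : TraceFamily k I) (D : PivotalStructure C) : Prop :=
  t.IsLeftMTrace D ∧ t.IsRightMTrace D

/-- For all `P` in `I`, the pairing `Hom(𝟙, P) × Hom(P, 𝟙) → k`, `(x, y) ↦ t_P (x ∘ y)`, is
non-degenerate (on both sides). -/
def TraceFamily.IsNondegenerate (t : TraceFamily k I) : Prop :=
  ∀ (P : C) (hP : I P),
    (∀ x : 𝟙_ C ⟶ P, (∀ y : P ⟶ 𝟙_ C, t P hP (y ≫ x) = 0) → x = 0) ∧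
    (∀ y : P ⟶ 𝟙_ C, (∀ x : 𝟙_ C ⟶ P, t P hP (y ≫ x) = 0) → y = 0)

/-- `L = ∑ x_i ∘ y_i`, where `(x_i)` is a basis of `Hom(𝟙, P)` and `(y_i)` is the basis of
`Hom(P, 𝟙)` dual to it with respect to the pairing `(x, y) ↦ t_P (x ∘ y)`. There is at most one such
`L`, since `∑ x_i ⊗ y_i` does not depend on the choice of the basis. -/
def TraceFamily.IsDualBasisSum (t : TraceFamily k I) (P : C) (hP : I P) (L : P ⟶ P) : Prop :=
  ∃ (n : ℕ) (x : Module.Basis (Fin n) k (𝟙_ C ⟶ P)) (y : Module.Basis (Fin n) k (P ⟶ 𝟙_ C)),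
    (∀ i j, t P hP (y j ≫ x i) = if i = j then 1 else 0) ∧ L = ∑ i, y i ≫ x i

/-- `G` is a generator of `I`: it lies in `I` and every identity morphism in `I` is a finite sum of
endomorphisms that factor through `G`. -/
def IsIdealGenerator (I : ObjectProperty C) (G : C) : Prop :=
  I G ∧ ∀ P : C, I P → ∃ (n : ℕ) (f : Fin n → (G ⟶ P)) (g : Fin n → (P ⟶ G)),
    𝟙 P = ∑ j, g j ≫ f j

/-- The morphism `(Id_G ⊗ evL_G ⊗ Id_G) ∘ (L ⊗ d) ∘ (Id_G ⊗ coevR_G ⊗ Id_G)`. -/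
def chromaticComposite (D : PivotalStructure C) {G : C} (L : G ⊗ D.dual G ⟶ G ⊗ D.dual G)
    (d : G ⊗ G ⟶ G ⊗ G) : G ⊗ G ⟶ G ⊗ G :=
  G ◁ ((λ_ G).inv ≫ D.coevR G ▷ G ≫ (α_ (D.dual G) G G).hom) ≫ (α_ G (D.dual G) (G ⊗ G)).inv ≫
    (L ⊗ₘ d) ≫
    (α_ G (D.dual G) (G ⊗ G)).hom ≫ G ◁ ((α_ (D.dual G) G G).inv ≫ D.evL G ▷ G ≫ (λ_ G).hom)

/-- `d` is a chromatic morphism for the object `G` of `I`, with respect to the modified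
trace `t`. -/
def TraceFamily.IsChromatic (t : TraceFamily k I) (D : PivotalStructure C) {G : C}
    (d : G ⊗ G ⟶ G ⊗ G) : Prop :=
  I G ∧ ∃ (h : I (G ⊗ D.dual G)) (L : G ⊗ D.dual G ⟶ G ⊗ D.dual G),
    t.IsDualBasisSum (G ⊗ D.dual G) h L ∧ chromaticComposite D L d = 𝟙 (G ⊗ G)

end General

/-! ### The category of finite-dimensional modules over a Hopf algebra -/

section Modules

/-- A finite-dimensional left module over the `k`-algebra `A`: a finite-dimensional vector space
with an algebra morphism from `A` to its endomorphisms. -/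
structure FDMod (k A : Type u) [Field k] [Ring A] [Algebra k A] where
  V : Type u
  [addCommGroup : AddCommGroup V]
  [module : Module k V]
  [finite : Module.Finite k V]
  ρ : A →ₐ[k] Module.End k V

namespace FDMod

variable {k A : Type u} [Field k] [Ring A]

attribute [instance] FDMod.addCommGroup FDMod.module FDMod.finite

section Algebra

variable [Algebra k A]

/-- `A`-linear maps. -/
@[ext]
structure Hom (M N : FDMod k A) where
  hom : M.V →ₗ[k] N.V
  comm : ∀ a : A, hom ∘ₗ M.ρ a = N.ρ a ∘ₗ hom

instance : Category (FDMod k A) where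
  Hom M N := Hom M N
  id M := ⟨LinearMap.id, fun _ => rfl⟩
  comp f g := ⟨g.hom ∘ₗ f.hom, fun a => by
    rw [LinearMap.comp_assoc, f.comm, ← LinearMap.comp_assoc, g.comm, LinearMap.comp_assoc]⟩

@[ext]
theorem hom_ext {M N : FDMod k A} {f g : M ⟶ N} (h : f.hom = g.hom) : f = g :=
  Hom.ext h

@[simp]
theorem id_hom (M : FDMod k A) : Hom.hom (𝟙 M) = LinearMap.id := rfl

@[simp]
theorem comp_hom {M N P : FDMod k A} (f : M ⟶ N) (g : N ⟶ P) :
    Hom.hom (f ≫ g) = g.hom ∘ₗ f.hom := rfl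

variable {M N : FDMod k A}

instance : Zero (M ⟶ N) := ⟨⟨0, fun a => by simp⟩⟩
instance : Add (M ⟶ N) :=
  ⟨fun f g => ⟨f.hom + g.hom, fun a => by
    rw [LinearMap.add_comp, LinearMap.comp_add, f.comm, g.comm]⟩⟩
instance : Neg (M ⟶ N) :=
  ⟨fun f => ⟨-f.hom, fun a => by rw [LinearMap.neg_comp, LinearMap.comp_neg, f.comm]⟩⟩
instance : Sub (M ⟶ N) :=
  ⟨fun f g => ⟨f.hom - g.hom, fun a => by
    rw [LinearMap.sub_comp, LinearMap.comp_sub, f.comm, g.comm]⟩⟩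
instance {S : Type*} [Monoid S] [DistribMulAction S N.V] [SMulCommClass k S N.V]
    [LinearMap.CompatibleSMul N.V N.V S k] : SMul S (M ⟶ N) :=
  ⟨fun c f => ⟨c • f.hom, fun a => by
    rw [LinearMap.smul_comp, LinearMap.comp_smul, f.comm]⟩⟩

theorem hom_injective : Function.Injective (fun f : M ⟶ N => f.hom) := fun _ _ h => hom_ext h

instance : AddCommGroup (M ⟶ N) :=
  hom_injective.addCommGroup (fun f : M ⟶ N => f.hom) rfl (fun _ _ => rfl) (fun _ => rfl)
    (fun _ _ => rfl) (fun _ _ => rfl) (fun _ _ => rfl)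

@[simp]
theorem add_hom (f g : M ⟶ N) : Hom.hom (f + g) = f.hom + g.hom := rfl

@[simp]
theorem smul_hom (c : k) (f : M ⟶ N) : Hom.hom (c • f) = c • f.hom := rfl

instance : Module k (M ⟶ N) :=
  hom_injective.module k ⟨⟨fun f : M ⟶ N => f.hom, rfl⟩, fun _ _ => rfl⟩ (fun _ _ => rfl)

instance : Preadditive (FDMod k A) where
  add_comp _ _ _ _ _ _ := hom_ext (LinearMap.comp_add _ _ _)
  comp_add _ _ _ _ _ _ := hom_ext (LinearMap.add_comp _ _ _)

instance : Linear k (FDMod k A) where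
  smul_comp _ _ _ _ _ _ := hom_ext (LinearMap.comp_smul _ _ _)
  comp_smul _ _ _ _ _ _ := hom_ext (LinearMap.smul_comp _ _ _)

/-- The left regular module. -/
abbrev regular (k A : Type u) [Field k] [Ring A] [Algebra k A] [Module.Finite k A] : FDMod k A where
  V := A
  ρ := Algebra.lmul k A

/-- The morphism from the regular module to `M` that carries `1` to `m`. -/
def ofElem [Module.Finite k A] (M : FDMod k A) (m : M.V) : regular k A ⟶ M where
  hom := LinearMap.applyₗ m ∘ₗ M.ρ.toLinearMap
  comm a := by
    refine LinearMap.ext fun (b : A) => ?_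
    change M.ρ (a * b) m = M.ρ a (M.ρ b m)
    rw [map_mul]
    rfl

end Algebra

section Bialgebra

variable [Bialgebra k A]

/-- The tensor product over `k`, on which `A` acts through the coproduct. -/
abbrev tensor (M N : FDMod k A) : FDMod k A where
  V := M.V ⊗[k] N.V
  ρ := (Module.endTensorEndAlgHom (R := k) (S := k) (A := k) (M := M.V) (N := N.V)).comp
    ((Algebra.TensorProduct.map M.ρ N.ρ).comp (Bialgebra.comulAlgHom k A))

variable (k A) in
/-- The ground field, on which `A` acts through the counit. -/
abbrev triv : FDMod k A where
  V := k
  ρ := (Algebra.lmul k k).comp (Bialgebra.counitAlgHom k A)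

theorem triv_ρ (a : A) (c : k) : (triv k A).ρ a c = Coalgebra.counit (R := k) a * c := rfl

/-- The linear map `a ↦ a • m`. -/
def orb (M : FDMod k A) (m : M.V) : A →ₗ[k] M.V := LinearMap.applyₗ m ∘ₗ M.ρ.toLinearMap

theorem orb_apply (M : FDMod k A) (m : M.V) (a : A) : M.orb m a = M.ρ a m := rfl

theorem tensor_ρ_tmul (M N : FDMod k A) (a : A) (m : M.V) (n : N.V) :
    (tensor M N).ρ a (m ⊗ₜ[k] n) =
      TensorProduct.map (M.orb m) (N.orb n) (Coalgebra.comul (R := k) a) := by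
  change Module.endTensorEndAlgHom (Algebra.TensorProduct.map M.ρ N.ρ (Coalgebra.comul a))
    (m ⊗ₜ[k] n) = _
  induction Coalgebra.comul (R := k) a with
  | zero => simp
  | add x y hx hy => rw [map_add, map_add, map_add, LinearMap.add_apply, hx, hy]
  | tmul x y => rfl

theorem hom_ρ {M N : FDMod k A} (f : M ⟶ N) (a : A) (m : M.V) :
    f.hom (M.ρ a m) = N.ρ a (f.hom m) := LinearMap.congr_fun (f.comm a) m

/-- The tensor product of two morphisms. -/
def tensorMap {M N M' N' : FDMod k A} (f : M ⟶ N) (g : M' ⟶ N') : tensor M M' ⟶ tensor N N' where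
  hom := TensorProduct.map f.hom g.hom
  comm a := by
    refine TensorProduct.ext' fun x y => ?_
    change TensorProduct.map f.hom g.hom ((tensor M M').ρ a (x ⊗ₜ[k] y)) =
      (tensor N N').ρ a (f.hom x ⊗ₜ[k] g.hom y)
    rw [tensor_ρ_tmul, tensor_ρ_tmul]
    induction Coalgebra.comul (R := k) a with
    | zero => simp
    | add x y hx hy => rw [map_add, map_add, map_add, hx, hy]
    | tmul x y => simp [orb_apply, hom_ρ]

/-- An invertible `A`-linear map is an isomorphism. -/
def mkIso {M N : FDMod k A} (e : M.V ≃ₗ[k] N.V)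
    (h : ∀ a : A, e.toLinearMap ∘ₗ M.ρ a = N.ρ a ∘ₗ e.toLinearMap) : M ≅ N where
  hom := ⟨e.toLinearMap, h⟩
  inv := ⟨e.symm.toLinearMap, fun a => by
    refine LinearMap.ext fun x => e.injective ?_
    have := LinearMap.congr_fun (h a) (e.symm x)
    simp at this
    simp [this]⟩
  hom_inv_id := hom_ext (LinearMap.ext fun x => e.symm_apply_apply x)
  inv_hom_id := hom_ext (LinearMap.ext fun x => e.apply_symm_apply x)

theorem assoc_act (M N P : FDMod k A) (a : A) :
    (TensorProduct.assoc k M.V N.V P.V).toLinearMap ∘ₗ (tensor (tensor M N) P).ρ a =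
      (tensor M (tensor N P)).ρ a ∘ₗ (TensorProduct.assoc k M.V N.V P.V).toLinearMap := by
  refine TensorProduct.ext_threefold fun m n p => ?_
  let T : A ⊗[k] (A ⊗[k] A) →ₗ[k] M.V ⊗[k] (N.V ⊗[k] P.V) :=
    TensorProduct.map (M.orb m) (TensorProduct.map (N.orb n) (P.orb p))
  have h₁ : ∀ z : A ⊗[k] A, TensorProduct.assoc k M.V N.V P.V
      (TensorProduct.map ((tensor M N).orb (m ⊗ₜ[k] n)) (P.orb p) z) =
      T (TensorProduct.assoc k A A A (Coalgebra.comul.rTensor A z)) := by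
    intro z
    induction z with
    | zero => simp
    | add x y hx hy => simp only [map_add]; rw [← hx, ← hy]
    | tmul x y =>
      change TensorProduct.assoc k M.V N.V P.V
        ((show M.V ⊗[k] N.V from (tensor M N).ρ x (m ⊗ₜ[k] n)) ⊗ₜ[k] P.ρ y p) = _
      rw [tensor_ρ_tmul, LinearMap.rTensor_tmul]
      induction Coalgebra.comul (R := k) x with
      | zero => simp
      | add u v hu hv => simp only [map_add, TensorProduct.add_tmul]; rw [hu, hv]
      | tmul u v => rfl
  have h₂ : ∀ z : A ⊗[k] A,
      TensorProduct.map (M.orb m) ((tensor N P).orb (n ⊗ₜ[k] p)) z =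
      T (Coalgebra.comul.lTensor A z) := by
    intro z
    induction z with
    | zero => simp
    | add x y hx hy => simp only [map_add]; rw [← hx, ← hy]
    | tmul x y =>
      change M.ρ x m ⊗ₜ[k] (show N.V ⊗[k] P.V from (tensor N P).ρ y (n ⊗ₜ[k] p)) = _
      rw [tensor_ρ_tmul]
      rfl
  exact (congrArg (TensorProduct.assoc k M.V N.V P.V)
      (tensor_ρ_tmul (tensor M N) P a (m ⊗ₜ[k] n) p)).trans ((h₁ _).trans
    ((congrArg T (Coalgebra.coassoc_apply a)).trans ((h₂ _).symm.trans
      (tensor_ρ_tmul M (tensor N P) a m (n ⊗ₜ[k] p)).symm)))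

theorem lid_act (M : FDMod k A) (a : A) :
    (TensorProduct.lid k M.V).toLinearMap ∘ₗ (tensor (triv k A) M).ρ a =
      M.ρ a ∘ₗ (TensorProduct.lid k M.V).toLinearMap := by
  refine TensorProduct.ext' fun (c : k) m => ?_
  change TensorProduct.lid k M.V ((tensor (triv k A) M).ρ a (c ⊗ₜ[k] m)) = M.ρ a (c • m)
  rw [tensor_ρ_tmul]
  have h : ∀ z : A ⊗[k] A, TensorProduct.lid k M.V
      (TensorProduct.map ((triv k A).orb c) (M.orb m) z) =
      c • M.orb m (TensorProduct.lid k A (Coalgebra.counit.rTensor A z)) := by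
    intro z
    induction z with
    | zero => simp
    | add x y hx hy => simp only [map_add, smul_add]; rw [← hx, ← hy]
    | tmul x y =>
      change (Coalgebra.counit (R := k) x * c) • M.ρ y m = _
      simp [orb_apply, mul_smul, smul_comm c]
  refine (h _).trans ?_
  simp [orb_apply]

theorem rid_act (M : FDMod k A) (a : A) :
    (TensorProduct.rid k M.V).toLinearMap ∘ₗ (tensor M (triv k A)).ρ a =
      M.ρ a ∘ₗ (TensorProduct.rid k M.V).toLinearMap := by
  refine TensorProduct.ext' fun m (c : k) => ?_
  change TensorProduct.rid k M.V ((tensor M (triv k A)).ρ a (m ⊗ₜ[k] c)) = M.ρ a (c • m)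
  rw [tensor_ρ_tmul]
  have h : ∀ z : A ⊗[k] A, TensorProduct.rid k M.V
      (TensorProduct.map (M.orb m) ((triv k A).orb c) z) =
      c • M.orb m (TensorProduct.rid k A (Coalgebra.counit.lTensor A z)) := by
    intro z
    induction z with
    | zero => simp
    | add x y hx hy => simp only [map_add, smul_add]; rw [← hx, ← hy]
    | tmul x y =>
      change (Coalgebra.counit (R := k) y * c) • M.ρ x m = _
      simp [orb_apply, mul_smul, smul_comm c]
  refine (h _).trans ?_
  simp [orb_apply]

instance : MonoidalCategoryStruct (FDMod k A) where
  tensorObj := tensor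
  whiskerLeft M _ _ f := tensorMap (𝟙 M) f
  whiskerRight f M := tensorMap f (𝟙 M)
  tensorHom := tensorMap
  tensorUnit := triv k A
  associator M N P := mkIso (TensorProduct.assoc k M.V N.V P.V) (assoc_act M N P)
  leftUnitor M := mkIso (TensorProduct.lid k M.V) (lid_act M)
  rightUnitor M := mkIso (TensorProduct.rid k M.V) (rid_act M)

instance : MonoidalCategory (FDMod k A) :=
  MonoidalCategory.ofTensorHom
    (id_tensorHom_id := fun _ _ => hom_ext TensorProduct.map_id)
    (id_tensorHom := fun _ _ _ _ => rfl)
    (tensorHom_id := fun _ _ => rfl)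
    (tensorHom_comp_tensorHom := fun _ _ _ _ => hom_ext (TensorProduct.map_comp _ _ _ _).symm)
    (associator_naturality := fun _ _ _ =>
      hom_ext (TensorProduct.ext_threefold fun _ _ _ => rfl))
    (leftUnitor_naturality := fun f => hom_ext (TensorProduct.ext' fun (c : k) x =>
      (map_smul f.hom c x).symm))
    (rightUnitor_naturality := fun f => hom_ext (TensorProduct.ext' fun x (c : k) =>
      (map_smul f.hom c x).symm))
    (pentagon := fun _ _ _ _ => hom_ext (TensorProduct.ext_fourfold fun _ _ _ _ => rfl))
    (triangle := fun _ _ => hom_ext (TensorProduct.ext_threefold fun x (c : k) y =>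
      (TensorProduct.smul_tmul c x y).symm))

end Bialgebra

section Hopf

variable [HopfAlgebra k A]

/-- The dual space, on which `a` acts by the transpose of the action of `S(a)`. -/
abbrev dual (M : FDMod k A) : FDMod k A where
  V := Module.Dual k M.V
  ρ := AlgHom.ofLinearMap
    (Module.Dual.transpose (R := k) (M := M.V) (M' := M.V) ∘ₗ M.ρ.toLinearMap ∘ₗ
      HopfAlgebra.antipode k)
    (by
      refine LinearMap.ext fun φ => LinearMap.ext fun x => ?_
      simp [Module.Dual.transpose_apply])
    (fun a b => by
      refine LinearMap.ext fun φ => LinearMap.ext fun x => ?_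
      simp [Module.Dual.transpose_apply, HopfAlgebra.antipode_mul_antidistrib])

theorem dual_ρ (M : FDMod k A) (a : A) (φ : Module.Dual k M.V) (x : M.V) :
    (dual M).ρ a φ x = φ (M.ρ (HopfAlgebra.antipode k a) x) := rfl

end Hopf

end FDMod

/-- A pivot of a Hopf algebra: a group-like element `g` such that `S²(x) = g x g⁻¹` for all `x`. -/
structure Pivot (k A : Type u) [Field k] [Ring A] [HopfAlgebra k A] where
  val : Aˣ
  isGroupLike : IsGroupLikeElem k (val : A)
  antipode_antipode (x : A) :
    HopfAlgebra.antipode k (HopfAlgebra.antipode k x) = (val : A) * x * ((val⁻¹ : Aˣ) : A)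

namespace FDMod

noncomputable section Pivotal

variable {k A : Type u} [Field k] [Ring A] [HopfAlgebra k A]

open Coalgebra HopfAlgebra

theorem tensor_ρ_repr (M N : FDMod k A) (a : A) (m : M.V) (n : N.V) :
    (tensor M N).ρ a (m ⊗ₜ[k] n) = ∑ i ∈ (ℛ k a).index,
      M.ρ ((ℛ k a).left i) m ⊗ₜ[k] N.ρ ((ℛ k a).right i) n := by
  rw [tensor_ρ_tmul, ← (ℛ k a).eq, map_sum]
  rfl

/-- `φ ⊗ x ↦ φ(x)` -/
def evL (M : FDMod k A) : tensor (dual M) M ⟶ triv k A where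
  hom := contractLeft k M.V
  comm a := by
    refine TensorProduct.ext' fun φ x => ?_
    change contractLeft k M.V ((tensor (dual M) M).ρ a (φ ⊗ₜ[k] x)) = counit (R := k) a * φ x
    rw [tensor_ρ_repr, map_sum]
    have h := congrArg (fun b => φ (M.ρ b x)) (sum_antipode_mul_eq_smul (ℛ k a))
    simpa [Module.Dual.transpose_apply] using h

/-- `x ⊗ φ ↦ φ(g x)` -/
def evR (g : Pivot k A) (M : FDMod k A) : tensor M (dual M) ⟶ triv k A where
  hom := contractRight k M.V ∘ₗ TensorProduct.map (M.ρ (g.val : A)) LinearMap.id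
  comm a := by
    refine TensorProduct.ext' fun x φ => ?_
    change (contractRight k M.V ∘ₗ TensorProduct.map (M.ρ (g.val : A)) LinearMap.id)
      ((tensor M (dual M)).ρ a (x ⊗ₜ[k] φ)) = counit (R := k) a * φ (M.ρ (g.val : A) x)
    rw [tensor_ρ_repr, map_sum]
    have h := congrArg (fun b => φ (M.ρ (antipode k b * (g.val : A)) x))
      (sum_antipode_mul_eq_smul (ℛ k a))
    have h' : ∀ b : A, (g.val : A) * b = antipode k (antipode k b) * (g.val : A) := fun b => by
      simp [g.antipode_antipode, mul_assoc]
    simp [antipode_mul_antidistrib, mul_assoc, ← h', Finset.sum_mul] at h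
    simpa [Module.Dual.transpose_apply] using h

theorem map_coevaluation (V : Type u) [AddCommGroup V] [Module k V] [Module.Finite k V]
    (f h : Module.End k V) :
    TensorProduct.map f (Module.Dual.transpose (R := k) h) (coevaluation k V 1) =
      TensorProduct.map (f ∘ₗ h) LinearMap.id (coevaluation k V 1) := by
  have h₁ : ∀ i, Module.Dual.transpose (R := k) h ((Module.Basis.ofVectorSpace k V).coord i) =
      ∑ j, (Module.Basis.ofVectorSpace k V).coord i (h (Module.Basis.ofVectorSpace k V j)) •
        (Module.Basis.ofVectorSpace k V).coord j := fun i =>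
    ((Module.Basis.ofVectorSpace k V).sum_dual_apply_smul_coord _).symm
  have h₂ : ∀ j, h (Module.Basis.ofVectorSpace k V j) =
      ∑ i, (Module.Basis.ofVectorSpace k V).coord i (h (Module.Basis.ofVectorSpace k V j)) •
        Module.Basis.ofVectorSpace k V i := fun j =>
    ((Module.Basis.ofVectorSpace k V).sum_repr _).symm
  rw [coevaluation_apply_one]
  simp only [map_sum, TensorProduct.map_tmul, LinearMap.comp_apply, LinearMap.id_apply]
  have h₃ : ∀ j, f (h (Module.Basis.ofVectorSpace k V j)) =
      ∑ i, (Module.Basis.ofVectorSpace k V).coord i (h (Module.Basis.ofVectorSpace k V j)) •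
        f (Module.Basis.ofVectorSpace k V i) := fun j => by
    conv_lhs => rw [h₂ j]
    simp only [map_sum, map_smul]
  simp_rw [h₁, h₃, TensorProduct.tmul_sum, TensorProduct.sum_tmul, TensorProduct.tmul_smul,
    TensorProduct.smul_tmul']
  exact Finset.sum_comm

/-- The linear map `a ↦ ∑ a e_i ⊗ e^i`. -/
def coevOrb (M : FDMod k A) : A →ₗ[k] M.V ⊗[k] Module.Dual k M.V :=
  LinearMap.applyₗ (coevaluation k M.V 1) ∘ₗ LinearMap.rTensorHom (Module.Dual k M.V) ∘ₗ
    M.ρ.toLinearMap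

theorem map_ρ_coevaluation (M : FDMod k A) (a b : A) :
    TensorProduct.map (M.ρ a) ((dual M).ρ b) (coevaluation k M.V 1) =
      M.coevOrb (a * antipode k b) := by
  refine (map_coevaluation M.V (M.ρ a) (M.ρ (antipode k b))).trans ?_
  change _ = TensorProduct.map (M.ρ (a * antipode k b)) LinearMap.id (coevaluation k M.V 1)
  rw [map_mul]
  rfl

/-- `1 ↦ ∑ e_i ⊗ e^i` -/
def coevL (M : FDMod k A) : triv k A ⟶ tensor M (dual M) where
  hom := coevaluation k M.V
  comm a := by
    refine LinearMap.ext_ring ?_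
    change coevaluation k M.V (counit (R := k) a * 1) =
      (tensor M (dual M)).ρ a (coevaluation k M.V 1)
    have h₁ : (tensor M (dual M)).ρ a = ∑ i ∈ (ℛ k a).index,
        TensorProduct.map (M.ρ ((ℛ k a).left i)) ((dual M).ρ ((ℛ k a).right i)) :=
      TensorProduct.ext' fun x φ => by
        rw [tensor_ρ_repr, LinearMap.sum_apply]
        rfl
    have h₃ := congrArg M.coevOrb (sum_mul_antipode_eq_smul (ℛ k a))
    rw [map_sum, map_smul] at h₃
    rw [h₁, LinearMap.sum_apply, Finset.sum_congr rfl fun i _ => map_ρ_coevaluation M _ _, h₃, ← smul_eq_mul, map_smul]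
    congr 1
    change _ = TensorProduct.map (M.ρ 1) LinearMap.id (coevaluation k M.V 1)
    rw [map_one M.ρ]
    exact (LinearMap.congr_fun TensorProduct.map_id _).symm

/-- `1 ↦ ∑ e^i ⊗ g⁻¹ e_i` -/
def coevR (g : Pivot k A) (M : FDMod k A) : triv k A ⟶ tensor (dual M) M where
  hom := (TensorProduct.comm k M.V (Module.Dual k M.V)).toLinearMap ∘ₗ
    TensorProduct.map (M.ρ ((g.val⁻¹ : Aˣ) : A)) LinearMap.id ∘ₗ coevaluation k M.V
  comm a := by
    refine LinearMap.ext_ring ?_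
    change TensorProduct.comm k M.V (Module.Dual k M.V)
        (TensorProduct.map (M.ρ ((g.val⁻¹ : Aˣ) : A)) LinearMap.id
          (coevaluation k M.V (counit (R := k) a * 1))) =
      (tensor (dual M) M).ρ a (TensorProduct.comm k M.V (Module.Dual k M.V)
        (TensorProduct.map (M.ρ ((g.val⁻¹ : Aˣ) : A)) LinearMap.id (coevaluation k M.V 1)))
    have h₁ : (tensor (dual M) M).ρ a ∘ₗ
        (TensorProduct.comm k M.V (Module.Dual k M.V)).toLinearMap ∘ₗ
        TensorProduct.map (M.ρ ((g.val⁻¹ : Aˣ) : A)) LinearMap.id =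
        (TensorProduct.comm k M.V (Module.Dual k M.V)).toLinearMap ∘ₗ ∑ i ∈ (ℛ k a).index,
        TensorProduct.map (M.ρ ((ℛ k a).right i * ((g.val⁻¹ : Aˣ) : A)))
          ((dual M).ρ ((ℛ k a).left i)) :=
      TensorProduct.ext' fun x φ => by
        change (tensor (dual M) M).ρ a (φ ⊗ₜ[k] M.ρ ((g.val⁻¹ : Aˣ) : A) x) = _
        rw [tensor_ρ_repr, LinearMap.comp_apply, LinearMap.sum_apply, map_sum]
        refine Finset.sum_congr rfl fun i _ => ?_
        rw [map_mul]
        rfl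
    have h' : ∀ b : A, b * ((g.val⁻¹ : Aˣ) : A) =
        ((g.val⁻¹ : Aˣ) : A) * antipode k (antipode k b) := fun b => by
      simp [g.antipode_antipode, mul_assoc]
    have h₄ : ∑ i ∈ (ℛ k a).index,
        ((ℛ k a).right i * ((g.val⁻¹ : Aˣ) : A)) * antipode k ((ℛ k a).left i) =
        counit (R := k) a • ((g.val⁻¹ : Aˣ) : A) := by
      have := congrArg (fun b => ((g.val⁻¹ : Aˣ) : A) * antipode k b)
        (sum_mul_antipode_eq_smul (ℛ k a))
      simp only [map_sum, antipode_mul_antidistrib, map_smul, antipode_one, Finset.mul_sum,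
        mul_smul_comm, mul_one] at this
      simpa only [h', mul_assoc] using this
    have h₃ := congrArg M.coevOrb h₄
    rw [map_sum, map_smul] at h₃
    have h₅ := LinearMap.congr_fun h₁ (coevaluation k M.V 1)
    rw [LinearMap.comp_apply _ (Finset.sum _ _), LinearMap.sum_apply,
      Finset.sum_congr rfl fun i _ => map_ρ_coevaluation M _ _, h₃] at h₅
    refine Eq.trans ?_ h₅.symm
    rw [← smul_eq_mul, map_smul, map_smul]
    rfl

theorem ρ_val_inv (g : Pivot k A) (M : FDMod k A) (m : M.V) :
    M.ρ (g.val : A) (M.ρ ((g.val⁻¹ : Aˣ) : A) m) = m := by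
  rw [← Module.End.mul_apply, ← map_mul, Units.mul_inv, map_one, Module.End.one_apply]

theorem ρ_inv_val (g : Pivot k A) (M : FDMod k A) (m : M.V) :
    M.ρ ((g.val⁻¹ : Aˣ) : A) (M.ρ (g.val : A) m) = m := by
  rw [← Module.End.mul_apply, ← map_mul, Units.inv_mul, map_one, Module.End.one_apply]

theorem leftMate_hom {X M : FDMod k A} (b : X ⊗ M ⟶ 𝟙_ (FDMod k A)) (x : X.V) (m : M.V) :
    (leftMate (D := dual M) (coevL M) b).hom x m = b.hom (x ⊗ₜ[k] m) := by
  change TensorProduct.lid k (Module.Dual k M.V) (TensorProduct.map b.hom LinearMap.id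
    ((TensorProduct.assoc k X.V M.V (Module.Dual k M.V)).symm
      (x ⊗ₜ[k] coevaluation k M.V 1))) m = _
  rw [coevaluation_apply_one]
  simp only [TensorProduct.tmul_sum, map_sum, TensorProduct.assoc_symm_tmul,
    TensorProduct.map_tmul, TensorProduct.lid_tmul, LinearMap.sum_apply]
  conv_rhs => rw [← (Module.Basis.ofVectorSpace k M.V).sum_repr m]
  simp only [TensorProduct.tmul_sum, map_sum, TensorProduct.tmul_smul, map_smul]
  exact Finset.sum_congr rfl fun i _ => mul_comm _ _

theorem rightMate_hom (g : Pivot k A) {X M : FDMod k A} (b : M ⊗ X ⟶ 𝟙_ (FDMod k A))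
    (x : X.V) (m : M.V) :
    (rightMate (D := dual M) (coevR g M) b).hom x m =
      b.hom (M.ρ ((g.val⁻¹ : Aˣ) : A) m ⊗ₜ[k] x) := by
  change TensorProduct.rid k (Module.Dual k M.V) (TensorProduct.map LinearMap.id b.hom
    (TensorProduct.assoc k (Module.Dual k M.V) M.V X.V
      ((TensorProduct.comm k M.V (Module.Dual k M.V)
        (TensorProduct.map (M.ρ ((g.val⁻¹ : Aˣ) : A)) LinearMap.id
          (coevaluation k M.V 1))) ⊗ₜ[k] x))) m = _
  rw [coevaluation_apply_one]
  simp only [TensorProduct.sum_tmul, map_sum, TensorProduct.assoc_tmul, TensorProduct.comm_tmul,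
    TensorProduct.map_tmul, TensorProduct.rid_tmul, LinearMap.sum_apply]
  conv_rhs => rw [← (Module.Basis.ofVectorSpace k M.V).sum_repr m]
  simp only [TensorProduct.sum_tmul, map_sum, map_smul]
  refine Finset.sum_congr rfl fun i _ => ?_
  rw [← TensorProduct.smul_tmul', map_smul]
  exact mul_comm _ _

/-- The pivotal structure on the category of finite-dimensional modules given by a pivot. -/
def pivotal (g : Pivot k A) : PivotalStructure (FDMod k A) where
  dual := dual
  coevL := coevL
  evL := evL
  coevR := coevR g
  evR := evR g
  coevL_evL M := hom_ext (contractLeft_assoc_coevaluation k M.V)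
  evL_coevL M := hom_ext (contractLeft_assoc_coevaluation' k M.V)
  coevR_evR M := by
    refine hom_ext (TensorProduct.ext' fun x (c : k) => ?_)
    change TensorProduct.map (contractRight k M.V ∘ₗ
        TensorProduct.map (M.ρ (g.val : A)) LinearMap.id) LinearMap.id
      ((TensorProduct.assoc k M.V (Module.Dual k M.V) M.V).symm (x ⊗ₜ[k]
        (TensorProduct.comm k M.V (Module.Dual k M.V)
          (TensorProduct.map (M.ρ ((g.val⁻¹ : Aˣ) : A)) LinearMap.id (coevaluation k M.V c))))) =
      1 ⊗ₜ[k] (c • x)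
    rw [← mul_one c, ← smul_eq_mul, map_smul, coevaluation_apply_one]
    simp only [TensorProduct.tmul_sum, map_sum, TensorProduct.assoc_symm_tmul, map_smul,
      TensorProduct.comm_tmul, TensorProduct.map_tmul, TensorProduct.tmul_smul,
      LinearMap.comp_apply, contractRight_apply, LinearMap.id_apply, smul_eq_mul, mul_one]
    congr 1
    have h := congrArg (M.ρ ((g.val⁻¹ : Aˣ) : A))
      ((Module.Basis.ofVectorSpace k M.V).sum_repr (M.ρ (g.val : A) x))
    rw [ρ_inv_val, map_sum] at h
    conv_rhs => rw [← h, TensorProduct.tmul_sum]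
    refine Finset.sum_congr rfl fun i _ => ?_
    rw [map_smul, TensorProduct.tmul_smul, TensorProduct.smul_tmul', smul_eq_mul, mul_one]
    rfl
  evR_coevR M := by
    refine hom_ext (TensorProduct.ext' fun (c : k) φ => ?_)
    change TensorProduct.map LinearMap.id (contractRight k M.V ∘ₗ
        TensorProduct.map (M.ρ (g.val : A)) LinearMap.id)
      (TensorProduct.assoc k (Module.Dual k M.V) M.V (Module.Dual k M.V)
        ((TensorProduct.comm k M.V (Module.Dual k M.V)
          (TensorProduct.map (M.ρ ((g.val⁻¹ : Aˣ) : A)) LinearMap.id (coevaluation k M.V c)))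
          ⊗ₜ[k] φ)) =
      (c • φ) ⊗ₜ[k] 1
    rw [← mul_one c, ← smul_eq_mul, map_smul, coevaluation_apply_one]
    simp only [TensorProduct.sum_tmul, map_sum, TensorProduct.assoc_tmul, map_smul,
      TensorProduct.comm_tmul, TensorProduct.map_tmul, ← TensorProduct.smul_tmul',
      LinearMap.comp_apply, contractRight_apply, LinearMap.id_apply, smul_eq_mul, mul_one,
      ρ_val_inv]
    congr 1
    conv_rhs => rw [← (Module.Basis.ofVectorSpace k M.V).sum_dual_apply_smul_coord φ,
      TensorProduct.sum_tmul]
    refine Finset.sum_congr rfl fun i _ => ?_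
    rw [TensorProduct.smul_tmul, smul_eq_mul, mul_one]
  transpose_eq {M N} f := by
    refine hom_ext (LinearMap.ext fun φ => LinearMap.ext fun m => ?_)
    rw [leftMate_hom, rightMate_hom]
    change φ (f.hom m) = φ (N.ρ (g.val : A) (f.hom (M.ρ ((g.val⁻¹ : Aˣ) : A) m)))
    rw [hom_ρ, ρ_val_inv]
  tensor_eq M N := by
    refine hom_ext (TensorProduct.ext' fun ψ φ => TensorProduct.ext' fun m n => ?_)
    refine (leftMate_hom (M := tensor M N) _ _ _).trans
      (Eq.trans ?_ (rightMate_hom g (M := tensor M N) _ _ _).symm)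
    have h : (tensor M N).ρ ((g.val⁻¹ : Aˣ) : A) (m ⊗ₜ[k] n) =
        M.ρ ((g.val⁻¹ : Aˣ) : A) m ⊗ₜ[k] N.ρ ((g.val⁻¹ : Aˣ) : A) n := by
      have h' : antipode k (g.val : A) = ((g.val⁻¹ : Aˣ) : A) :=
        Units.eq_inv_of_mul_eq_one_left g.isGroupLike.mul_antipode_cancel
      rw [tensor_ρ_tmul, ← h', g.isGroupLike.antipode.comul_eq_tmul_self]
      rfl
    rw [h]
    change ψ ((φ m) • n) = ψ (N.ρ (g.val : A) (N.ρ ((g.val⁻¹ : Aˣ) : A) n)) •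
      φ (M.ρ (g.val : A) (M.ρ ((g.val⁻¹ : Aˣ) : A) m))
    rw [ρ_val_inv, ρ_val_inv, map_smul, smul_eq_mul, smul_eq_mul, mul_comm]

end Pivotal

end FDMod

end Modules

/-! ### Integrals, unimodular and unibalanced Hopf algebras -/

noncomputable section Hopf

variable {k A : Type u} [Field k] [Ring A] [HopfAlgebra k A]

/-- A right integral: a linear form `l` such that `(l ⊗ Id)(Δ(x)) = l(x) 1` for all `x`. -/
def IsRightIntegral (l : A →ₗ[k] k) : Prop :=
  ∀ x : A, TensorProduct.lid k A (l.rTensor A (Coalgebra.comul x)) = l x • (1 : A)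

variable (k) in
/-- A left cointegral: a vector `c` such that `x c = ε(x) c` for all `x`. -/
def IsLeftCointegral (c : A) : Prop :=
  ∀ x : A, x * c = Coalgebra.counit (R := k) x • c

variable (k A) in
/-- `A` is unimodular if `S` fixes the left cointegrals (which form a line). -/
def IsUnimodular : Prop :=
  ∀ c : A, IsLeftCointegral k c → HopfAlgebra.antipode k c = c

/-- The Hopf algebra `A` with the pivot `g` is unibalanced if the left modified traces on the ideal
of projective objects (which form a line if `A` is unimodular) are also right modified traces. -/
def IsUnibalanced (g : Pivot k A) : Prop :=
  ∀ t : TraceFamily k (isProjective (FDMod k A)),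
    t.IsLeftMTrace (FDMod.pivotal g) → t.IsRightMTrace (FDMod.pivotal g)

namespace FDMod

variable [Module.Finite k A]

variable (k A) in
/-- The counit, as a morphism from the regular module to the unit object. -/
def counitHom : regular k A ⟶ 𝟙_ (FDMod k A) where
  hom := Coalgebra.counit
  comm a := LinearMap.ext fun (x : A) => Bialgebra.counit_mul a x

variable (k A) in
/-- The coproduct, as a morphism from the regular module to its tensor square. -/
def comulHom : regular k A ⟶ regular k A ⊗ regular k A where
  hom := Coalgebra.comul
  comm a := LinearMap.ext fun (x : A) => by
    change Coalgebra.comul (R := k) (a * x) =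
      (tensor (regular k A) (regular k A)).ρ a (Coalgebra.comul (R := k) x)
    rw [Bialgebra.comul_mul]
    induction Coalgebra.comul (R := k) x with
    | zero => simp
    | add y z hy hz => rw [mul_add, hy, hz, map_add]
    | tmul y z =>
      rw [tensor_ρ_tmul]
      induction Coalgebra.comul (R := k) a with
      | zero => simp
      | add u v hu hv => rw [add_mul, hu, hv, map_add]
      | tmul u v => rw [Algebra.TensorProduct.tmul_mul_tmul]; rfl

/-- The morphism from the unit object to the regular module that carries `1` to the left
cointegral `c`. -/
def cointegralHom (c : A) (hc : IsLeftCointegral k c) : 𝟙_ (FDMod k A) ⟶ regular k A where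
  hom := LinearMap.toSpanSingleton k A c
  comm a := LinearMap.ext_ring <| by
    change (Coalgebra.counit (R := k) a * 1) • c = a * ((1 : k) • c)
    rw [mul_one, one_smul, hc a]

/-- The morphism from the regular module `A` to `A* ⊗ A` that carries `1` to `l ⊗ 1`. -/
def integralHom (l : A →ₗ[k] k) : regular k A ⟶ dual (regular k A) ⊗ regular k A :=
  ofElem (dual (regular k A) ⊗ regular k A) (l ⊗ₜ[k] (1 : A))

/-- The morphism `(evR_A ⊗ Id_{A ⊗ A}) ∘ (Id_A ⊗ f ⊗ Id_A) ∘ (Id_A ⊗ Δ)`, where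
`f : A ⟶ A* ⊗ A` carries `1` to `l ⊗ 1`. -/
def dTilde (g : Pivot k A) (l : A →ₗ[k] k) :
    regular k A ⊗ regular k A ⟶ regular k A ⊗ regular k A :=
  regular k A ◁ (comulHom k A ≫ integralHom l ▷ regular k A ≫
      (α_ (dual (regular k A)) (regular k A) (regular k A)).hom) ≫
    (α_ (regular k A) (dual (regular k A)) (regular k A ⊗ regular k A)).inv ≫
    (pivotal g).evR (regular k A) ▷ (regular k A ⊗ regular k A) ≫
    (λ_ (regular k A ⊗ regular k A)).hom

end FDMod

end Hopf

/-! Sweedler notation is used throughout, with `λ` and `Λ` for the integral and the cointegral (`l`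
and `c` in the code), and `ρ(w) = g⁻¹w` for the pivot action.

Algebra. For a right integral one has `λ(a b₁) S(b₂) = λ(a₁ b) a₂`. Putting `b = Λ` or `a = Λ`,
where unimodularity makes `Λ` two-sided, shows that the form `λ(xy)` is non-degenerate, with dual
bases given by `Λ₁ ⊗ S(Λ₂)`. Three facts follow: cointegrals form a line, `λ(S(Λ₂) b) Λ₁ = b`, and
`S²` is the Nakayama automorphism, `λ(S²(y) b) = λ(b y)`. Existence of a pair comes from trace
formulas: a trace built from left multiplication and `S²` gives a nonzero cointegral, and a dual
averaging turns any form `f` into an integral with the same value as `f` on left cointegrals. The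
pivot makes `S` bijective and makes `S²` inner.

Trace. By the Nakayama property `τ(a) = λ(S(a) g)` is symmetric, so it defines a cyclic form on
`End(A)`, which is the opposite algebra of `A`. It extends to every projective object, since each
identity morphism is a sum of morphisms through `A`. Because `W ⊗ A` is free, the left partial trace
property reduces to `τ(a₂) a₁ = τ(a) g`, a rewriting of the integral property of `λ`. The
unibalanced hypothesis supplies the right partial trace property. Non-degeneracy holds because
`Hom(A, 𝟙)` and `Hom(𝟙, A)` are spanned by `ε` and `Λ`, and `t_A(Λ ∘ ε) = τ(Λ) = 1`.

Chromatic identity. Trivializing `A ⊗ A*` as a free module gives `Λ_{A ⊗ A*}(a ⊗ φ) = Λ₁ ⊗ Λ₂ S(a)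
φ`, while `d̃(y ⊗ x) = λ(S(x₁) g y) x₂ ⊗ x₃`. In the composite the pivots cancel, and contracting
the dual bases leaves `λ(S(x₁) S²(a) S(Λ₂) x₂) Λ₁ ⊗ x₃`. The Nakayama property, applied to `x₂` and
then to `a`, reduces this to `λ(S(Λ₂) a) Λ₁ ⊗ x = a ⊗ x`. -/

/-! ### Antipode identities obtained in the convolution algebra `Hom(A, A ⊗ A)`. -/

noncomputable section HopfIdentities

variable {k A : Type u} [Field k] [Ring A] [HopfAlgebra k A]

open Coalgebra HopfAlgebra WithConv Algebra.TensorProduct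

variable (k A) in
/-- The map `a ↦ a ⊗ 1`, as an element of the convolution algebra. -/
def convLeft : WithConv (A →ₗ[k] A ⊗[k] A) := toConv (includeLeft (R := k) (S := k)).toLinearMap

variable (k A) in
/-- The map `a ↦ 1 ⊗ a`, as an element of the convolution algebra. -/
def convRight : WithConv (A →ₗ[k] A ⊗[k] A) := toConv (includeRight (R := k)).toLinearMap

variable (k A) in
/-- The map `a ↦ S(a) ⊗ 1`, as an element of the convolution algebra. -/
def convLeftAntipode : WithConv (A →ₗ[k] A ⊗[k] A) :=
  toConv ((includeLeft (R := k) (S := k)).toLinearMap ∘ₗ antipode k)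

variable (k A) in
/-- The map `a ↦ 1 ⊗ S(a)`, as an element of the convolution algebra. -/
def convRightAntipode : WithConv (A →ₗ[k] A ⊗[k] A) :=
  toConv ((includeRight (R := k)).toLinearMap ∘ₗ antipode k)

theorem algHom_comp_convOne {B C : Type u} [Ring B] [Algebra k B] [Ring C] [Algebra k C]
    (h : B →ₐ[k] C) :
    toConv (h.toLinearMap ∘ₗ (1 : WithConv (A →ₗ[k] B)).ofConv) = 1 := by
  ext a; simp [LinearMap.convOne_def]

theorem convLeft_mul_antipode : convLeft k A * convLeftAntipode k A = 1 := by
  have h := LinearMap.algHom_comp_convMul_distrib (includeLeft (R := k) (S := k) (A := A) (B := A))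
    (toConv LinearMap.id) (toConv (antipode k (A := A)))
  rw [LinearMap.id_mul_antipode] at h
  exact (congrArg toConv h).symm.trans (algHom_comp_convOne _)

theorem convLeft_antipode_mul : convLeftAntipode k A * convLeft k A = 1 := by
  have h := LinearMap.algHom_comp_convMul_distrib (includeLeft (R := k) (S := k) (A := A) (B := A))
    (toConv (antipode k (A := A))) (toConv LinearMap.id)
  rw [LinearMap.antipode_mul_id] at h
  exact (congrArg toConv h).symm.trans (algHom_comp_convOne _)

theorem convRight_mul_antipode : convRight k A * convRightAntipode k A = 1 := by
  have h := LinearMap.algHom_comp_convMul_distrib (includeRight (R := k) (A := A) (B := A))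
    (toConv LinearMap.id) (toConv (antipode k (A := A)))
  rw [LinearMap.id_mul_antipode] at h
  exact (congrArg toConv h).symm.trans (algHom_comp_convOne _)

theorem convRight_antipode_mul : convRightAntipode k A * convRight k A = 1 := by
  have h := LinearMap.algHom_comp_convMul_distrib (includeRight (R := k) (A := A) (B := A))
    (toConv (antipode k (A := A))) (toConv LinearMap.id)
  rw [LinearMap.antipode_mul_id] at h
  exact (congrArg toConv h).symm.trans (algHom_comp_convOne _)

/-- This factorization of `Δ` into two convolution-invertible maps reduces the identities below to
cancellations in a monoid. -/
theorem convLeft_mul_convRight : convLeft k A * convRight k A = toConv comul := by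
  ext a
  rw [(ℛ k a).convMul_apply]
  simpa [convLeft, convRight] using (ℛ k a).eq

/-- Both sides are convolution inverses of `Δ`, one from the factorization of `Δ` and one from the
antipode axiom; inverses are unique. -/
theorem convRightAntipode_mul_convLeftAntipode :
    convRightAntipode k A * convLeftAntipode k A = toConv (comul ∘ₗ antipode k) := by
  refine left_inv_eq_right_inv (a := toConv comul) ?_ LinearMap.comul_right_inv
  rw [← convLeft_mul_convRight, mul_assoc, ← mul_assoc (convLeftAntipode k A),
    convLeft_antipode_mul, one_mul, convRight_antipode_mul]

/-- `Δ(S(a)) = S(a₂) ⊗ S(a₁)` -/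
theorem comul_antipode_repr (a : A) : comul (R := k) (antipode k a) =
    ∑ i ∈ (ℛ k a).index, antipode k ((ℛ k a).right i) ⊗ₜ[k] antipode k ((ℛ k a).left i) := by
  have h := congrArg (fun F : WithConv (A →ₗ[k] A ⊗[k] A) => F a)
    (convRightAntipode_mul_convLeftAntipode (k := k) (A := A))
  simp only [(ℛ k a).convMul_apply] at h
  simpa [convRightAntipode, convLeftAntipode] using h.symm

/-- `Δ(a₁) (1 ⊗ S(a₂)) = a ⊗ 1` -/
theorem sum_comul_mul_one_tmul_antipode (a : A) :
    ∑ i ∈ (ℛ k a).index, comul (R := k) ((ℛ k a).left i) *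
      ((1 : A) ⊗ₜ[k] antipode k ((ℛ k a).right i)) = a ⊗ₜ[k] 1 := by
  have h : toConv comul * convRightAntipode k A = convLeft k A := by
    rw [← convLeft_mul_convRight, mul_assoc, convRight_mul_antipode, mul_one]
  have h := congrArg (fun F : WithConv (A →ₗ[k] A ⊗[k] A) => F a) h
  simp only [(ℛ k a).convMul_apply] at h
  simpa [convRightAntipode, convLeft] using h

/-- `(a₁ ⊗ 1) (S ⊗ id) Δ(a₂) = 1 ⊗ a` -/
theorem sum_tmul_one_mul_map_antipode (a : A) :
    ∑ i ∈ (ℛ k a).index, ((ℛ k a).left i ⊗ₜ[k] (1 : A)) *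
      TensorProduct.map (antipode k) LinearMap.id (comul (R := k) ((ℛ k a).right i)) =
      1 ⊗ₜ[k] a := by
  have h₁ : convLeftAntipode k A * convRight k A =
      toConv (TensorProduct.map (antipode k) LinearMap.id ∘ₗ comul) := by
    ext a
    simp only [(ℛ k a).convMul_apply]
    simp [convLeftAntipode, convRight, ← (ℛ k a).eq]
  have h : convLeft k A * toConv (TensorProduct.map (antipode k) LinearMap.id ∘ₗ comul) =
      convRight k A := by
    rw [← h₁, ← mul_assoc, convLeft_mul_antipode, one_mul]
  have h := congrArg (fun F : WithConv (A →ₗ[k] A ⊗[k] A) => F a) h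
  simp only [(ℛ k a).convMul_apply] at h
  simpa [convRight, convLeft] using h

/-- `(id ⊗ S) Δ(a₁) (1 ⊗ a₂) = a ⊗ 1` -/
theorem sum_map_antipode_mul_one_tmul (a : A) :
    ∑ i ∈ (ℛ k a).index,
      TensorProduct.map LinearMap.id (antipode k) (comul (R := k) ((ℛ k a).left i)) *
      ((1 : A) ⊗ₜ[k] (ℛ k a).right i) = a ⊗ₜ[k] 1 := by
  have h₁ : convLeft k A * convRightAntipode k A =
      toConv (TensorProduct.map LinearMap.id (antipode k) ∘ₗ comul) := by
    ext a
    simp only [(ℛ k a).convMul_apply]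
    simp [convRightAntipode, convLeft, ← (ℛ k a).eq]
  have h : toConv (TensorProduct.map LinearMap.id (antipode k) ∘ₗ comul) * convRight k A =
      convLeft k A := by
    rw [← h₁, mul_assoc, convRight_antipode_mul, mul_one]
  have h := congrArg (fun F : WithConv (A →ₗ[k] A ⊗[k] A) => F a) h
  simp only [(ℛ k a).convMul_apply] at h
  simpa [convRight, convLeft] using h

/-- The action `x ↦ f(x₁) x₂` of a linear form `f` on the Hopf algebra. -/
def formAct (f : A →ₗ[k] k) : A →ₗ[k] A :=
  (TensorProduct.lid k A).toLinearMap ∘ₗ f.rTensor A ∘ₗ comul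

theorem formAct_repr (f : A →ₗ[k] k) (x : A) :
    formAct f x = ∑ i ∈ (ℛ k x).index, f ((ℛ k x).left i) • (ℛ k x).right i := by
  rw [formAct, LinearMap.comp_apply, LinearMap.comp_apply, ← (ℛ k x).eq]
  simp

/-- Coassociativity: both sides are `f(x₁) x₂ ⊗ x₃`. -/
theorem comul_formAct (f : A →ₗ[k] k) (x : A) :
    comul (R := k) (formAct f x) = TensorProduct.map (formAct f) LinearMap.id (comul x) := by
  have h := congrArg (fun z => TensorProduct.lid k (A ⊗[k] A) (f.rTensor (A ⊗[k] A) z))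
    (coassoc_apply (R := k) x)
  simp only [← (ℛ k x).eq, map_sum, LinearMap.lTensor_tmul, LinearMap.rTensor_tmul,
    TensorProduct.lid_tmul, TensorProduct.map_tmul] at h ⊢
  rw [formAct_repr, map_sum]
  simp only [map_smul]
  rw [← h]
  refine Finset.sum_congr rfl fun i _ => ?_
  rw [formAct_repr, ← (ℛ k ((ℛ k x).left i)).eq]
  simp [TensorProduct.sum_tmul, TensorProduct.smul_tmul']

end HopfIdentities

/-! ### The Frobenius structure given by an integral and a dual cointegral. -/

noncomputable section Integrals

variable {k A : Type u} [Field k] [Ring A] [HopfAlgebra k A]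

open Coalgebra HopfAlgebra WithConv

namespace Pivot

theorem antipode_val (g : Pivot k A) : antipode k (g.val : A) = ((g.val⁻¹ : Aˣ) : A) :=
  Units.eq_inv_of_mul_eq_one_left g.isGroupLike.mul_antipode_cancel

theorem isGroupLike_inv (g : Pivot k A) : IsGroupLikeElem k ((g.val⁻¹ : Aˣ) : A) := by
  rw [← g.antipode_val]
  exact g.isGroupLike.antipode

theorem antipode_val_inv (g : Pivot k A) : antipode k ((g.val⁻¹ : Aˣ) : A) = (g.val : A) := by
  rw [← g.antipode_val, g.isGroupLike.antipode_antipode]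

/-- The inverse of the antipode. -/
def antipodeInv (g : Pivot k A) : A →ₗ[k] A :=
  LinearMap.mulRight k (g.val : A) ∘ₗ LinearMap.mulLeft k ((g.val⁻¹ : Aˣ) : A) ∘ₗ antipode k

theorem antipodeInv_apply (g : Pivot k A) (x : A) :
    g.antipodeInv x = ((g.val⁻¹ : Aˣ) : A) * antipode k x * (g.val : A) := rfl

@[simp]
theorem antipode_antipodeInv (g : Pivot k A) (x : A) : antipode k (g.antipodeInv x) = x := by
  rw [antipodeInv_apply, antipode_mul_antidistrib, antipode_mul_antidistrib, g.antipode_antipode,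
    g.antipode_val, g.antipode_val_inv]
  simp [mul_assoc]

@[simp]
theorem antipodeInv_antipode (g : Pivot k A) (x : A) : g.antipodeInv (antipode k x) = x := by
  rw [antipodeInv_apply, g.antipode_antipode]
  simp [mul_assoc]

theorem antipode_injective (g : Pivot k A) : Function.Injective (antipode k (A := A)) :=
  Function.LeftInverse.injective g.antipodeInv_antipode

theorem antipodeInv_mul (g : Pivot k A) (x y : A) :
    g.antipodeInv (x * y) = g.antipodeInv y * g.antipodeInv x :=
  g.antipode_injective (by simp [antipode_mul_antidistrib])

theorem antipodeInv_one (g : Pivot k A) : g.antipodeInv 1 = 1 := by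
  simp [antipodeInv_apply]

end Pivot

/-- The antipode reverses products and fixes `c`, so it carries the left cointegral property to the
right one; the pivot provides its inverse. -/
theorem IsLeftCointegral.mul_eq (g : Pivot k A) (hA : IsUnimodular k A) {c : A}
    (hc : IsLeftCointegral k c) (x : A) : c * x = counit (R := k) x • c := by
  have h := congrArg (antipode k) (hc (g.antipodeInv x))
  rw [antipode_mul_antidistrib, hA c hc, map_smul, hA c hc, g.antipode_antipodeInv] at h
  rw [h, ← counit_antipode, g.antipode_antipodeInv]

/-- `l(a b₁) S(b₂) = l(a₁ b) a₂` -/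
theorem IsRightIntegral.sum_mul_antipode {l : A →ₗ[k] k} (hl : IsRightIntegral l) (a b : A) :
    ∑ i ∈ (ℛ k b).index, l (a * (ℛ k b).left i) • antipode k ((ℛ k b).right i) =
      ∑ i ∈ (ℛ k a).index, l ((ℛ k a).left i * b) • (ℛ k a).right i := by
  let P : WithConv (A →ₗ[k] A) := toConv ((l ∘ₗ LinearMap.mulLeft k a).smulRight (1 : A))
  let Q : WithConv (A →ₗ[k] A) := toConv (∑ i ∈ (ℛ k a).index,
    (l ∘ₗ LinearMap.mulLeft k ((ℛ k a).left i)).smulRight ((ℛ k a).right i))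
  -- This is the integral property at the product `a b`, namely `l(a₁ b₁) a₂ b₂ = l(a b) 1`;
  -- convolving with `S` on the right moves `b₂` to the other side.
  have h : Q * toConv LinearMap.id = P := by
    ext b
    have h₁ : formAct l (a * b) = l (a * b) • (1 : A) := hl (a * b)
    simp only [formAct, LinearMap.comp_apply, Bialgebra.comul_mul] at h₁
    rw [(ℛ k b).convMul_apply]
    rw [← (ℛ k b).eq, ← (ℛ k a).eq] at h₁
    simp only [Finset.sum_mul, Finset.mul_sum, Algebra.TensorProduct.tmul_mul_tmul, map_sum,
      LinearMap.rTensor_tmul, LinearEquiv.coe_coe, TensorProduct.lid_tmul] at h₁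
    simpa [P, Q, Finset.sum_mul] using h₁
  have h' : Q = P * toConv (antipode k) := by
    rw [← h, mul_assoc, LinearMap.id_mul_antipode, mul_one]
  have hPQ := congrArg (fun F : WithConv (A →ₗ[k] A) => F b) h'
  simp only [(ℛ k b).convMul_apply] at hPQ
  simpa [P, Q] using hPQ.symm

/-- A right integral and a left cointegral that are dual to each other. -/
structure IsIntegralPair (l : A →ₗ[k] k) (c : A) : Prop where
  isRightIntegral : IsRightIntegral l
  isLeftCointegral : IsLeftCointegral k c
  apply_eq_one : l c = 1

namespace IsIntegralPair

variable {l : A →ₗ[k] k} {c : A}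

/-- The case `b = c` of the exchange identity `l(a b₁) S(b₂) = l(a₁ b) a₂`. -/
theorem sum_smul_antipode (h : IsIntegralPair l c) (a : A) :
    ∑ i ∈ (ℛ k c).index, l (a * (ℛ k c).left i) • antipode k ((ℛ k c).right i) = a := by
  rw [h.isRightIntegral.sum_mul_antipode]
  conv_rhs => rw [← sum_counit_smul (ℛ k a)]
  refine Finset.sum_congr rfl fun i _ => ?_
  rw [h.isLeftCointegral, map_smul, h.apply_eq_one, smul_eq_mul, mul_one]

/-- The case `a = c` of the exchange identity; here `c` must absorb factors on its right, whence
unimodularity. -/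
theorem sum_smul_right (h : IsIntegralPair l c) (g : Pivot k A) (hA : IsUnimodular k A) (b : A) :
    ∑ i ∈ (ℛ k c).index, l ((ℛ k c).left i * b) • (ℛ k c).right i = antipode k b := by
  rw [← h.isRightIntegral.sum_mul_antipode]
  conv_rhs => rw [← sum_counit_smul (ℛ k b), map_sum]
  refine Finset.sum_congr rfl fun i _ => ?_
  rw [h.isLeftCointegral.mul_eq g hA, map_smul, map_smul, h.apply_eq_one, smul_eq_mul, mul_one]

theorem eq_of_forall_mul (h : IsIntegralPair l c) (g : Pivot k A) (hA : IsUnimodular k A)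
    {x y : A} (hxy : ∀ a, l (a * x) = l (a * y)) : x = y := by
  apply g.antipode_injective
  rw [← h.sum_smul_right g hA, ← h.sum_smul_right g hA]
  simp only [hxy]

/-- The other half of the dual-basis property of `c₁ ⊗ S(c₂)`: after pairing with any `a` it becomes
`sum_smul_antipode`, and the pairing is non-degenerate. -/
theorem sum_smul_left (h : IsIntegralPair l c) (g : Pivot k A) (hA : IsUnimodular k A) (b : A) :
    ∑ i ∈ (ℛ k c).index, l (antipode k ((ℛ k c).right i) * b) • (ℛ k c).left i = b := by
  refine h.eq_of_forall_mul g hA fun a => ?_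
  conv_rhs => rw [← h.sum_smul_antipode a]
  simp [Finset.mul_sum, Finset.sum_mul, mul_comm]

/-- `l(S²(y) b) = l(b y)` -/
theorem antipode_antipode_mul (h : IsIntegralPair l c) (g : Pivot k A) (hA : IsUnimodular k A)
    (y b : A) : l (antipode k (antipode k y) * b) = l (b * y) := by
  -- With `b = l(S(c₂) b) c₁`, the right side becomes `l(S(c₂) b) l(c₁ y)`, and `l(c₁ y) c₂ = S(y)`.
  conv_rhs => rw [← h.sum_smul_left g hA b]
  rw [← h.sum_smul_right g hA y]
  simp [Finset.sum_mul, mul_comm]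

/-- Uniqueness of cointegrals up to scalars: `S(x) = l(c₁ x) c₂ = l(x) c = S(l(x) c)`, and `S` is
injective. -/
theorem eq_smul (h : IsIntegralPair l c) (g : Pivot k A) (hA : IsUnimodular k A) {x : A}
    (hx : IsLeftCointegral k x) : x = l x • c := by
  apply g.antipode_injective
  rw [← h.sum_smul_right g hA, map_smul, hA c h.isLeftCointegral]
  conv_rhs => rw [← sum_counit_smul (ℛ k c), Finset.smul_sum]
  refine Finset.sum_congr rfl fun i _ => ?_
  rw [hx, map_smul, smul_smul, smul_eq_mul, mul_comm]

end IsIntegralPair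

/-- The linear form `a ↦ l(S(g⁻¹ a))`, where `l` is a right integral. -/
def symmetrizedIntegral (g : Pivot k A) (l : A →ₗ[k] k) : A →ₗ[k] k :=
  l ∘ₗ antipode k ∘ₗ LinearMap.mulLeft k ((g.val⁻¹ : Aˣ) : A)

theorem symmetrizedIntegral_apply (g : Pivot k A) (l : A →ₗ[k] k) (a : A) :
    symmetrizedIntegral g l a = l (antipode k a * (g.val : A)) := by
  simp [symmetrizedIntegral, antipode_mul_antidistrib, g.antipode_val_inv]

theorem IsIntegralPair.symmetrizedIntegral_mul_comm {l : A →ₗ[k] k} {c : A}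
    (h : IsIntegralPair l c) (g : Pivot k A) (hA : IsUnimodular k A) (a b : A) :
    symmetrizedIntegral g l (a * b) = symmetrizedIntegral g l (b * a) := by
  simp only [symmetrizedIntegral_apply, antipode_mul_antidistrib]
  -- The element `y = g⁻¹ S(b) g` is chosen so that `S²(y) = S(b)`; the factor `g` in the form then
  -- compensates the Nakayama automorphism.
  have h' := h.antipode_antipode_mul g hA (((g.val⁻¹ : Aˣ) : A) * antipode k b * (g.val : A))
    (antipode k a * (g.val : A))
  rw [g.antipode_antipode] at h'
  simpa [mul_assoc] using h'

theorem IsIntegralPair.symmetrizedIntegral_cointegral {l : A →ₗ[k] k} {c : A}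
    (h : IsIntegralPair l c) (g : Pivot k A) (hA : IsUnimodular k A) :
    symmetrizedIntegral g l c = 1 := by
  rw [symmetrizedIntegral_apply, hA c h.isLeftCointegral, h.isLeftCointegral.mul_eq g hA,
    g.isGroupLike.counit_eq_one, one_smul, h.apply_eq_one]

/-- `t(a₂) a₁ = t(a) g` for the symmetrized integral `t` -/
theorem IsRightIntegral.sum_symmetrizedIntegral {l : A →ₗ[k] k} (hl : IsRightIntegral l)
    (g : Pivot k A) (a : A) :
    ∑ i ∈ (ℛ k a).index, symmetrizedIntegral g l ((ℛ k a).right i) • (ℛ k a).left i =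
      symmetrizedIntegral g l a • (g.val : A) := by
  -- Since `Δ(S(a) g) = S(a₂) g ⊗ S(a₁) g`, the integral property here is the `S`-image of the
  -- claim, up to a factor `g` on the right.
  have h := hl (antipode k a * (g.val : A))
  rw [Bialgebra.comul_mul, comul_antipode_repr, g.isGroupLike.comul_eq_tmul_self] at h
  simp only [Finset.sum_mul, Algebra.TensorProduct.tmul_mul_tmul, map_sum,
    LinearMap.rTensor_tmul, TensorProduct.lid_tmul, ← symmetrizedIntegral_apply] at h
  apply g.antipode_injective
  have h' := congrArg (· * ((g.val⁻¹ : Aˣ) : A)) h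
  simpa [Finset.sum_mul, mul_assoc, g.antipode_val] using h'

end Integrals

/-! ### Existence of integrals and cointegrals by trace formulas. -/

noncomputable section IntegralExistence

variable {k A : Type u} [Field k] [Ring A] [HopfAlgebra k A]

open Coalgebra HopfAlgebra WithConv

theorem formAct_formAct (f h : A →ₗ[k] k) (x : A) :
    formAct h (formAct f x) = formAct (toConv f * toConv h).ofConv x := by
  have e : formAct h (formAct f x) = TensorProduct.lid k A
      (TensorProduct.map (h ∘ₗ formAct f) LinearMap.id (comul x)) := by
    change TensorProduct.lid k A (h.rTensor A (comul (formAct f x))) = _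
    rw [comul_formAct, ← (ℛ k x).eq]
    simp
  rw [e, formAct_repr, ← (ℛ k x).eq]
  simp only [map_sum, TensorProduct.map_tmul, TensorProduct.lid_tmul]
  refine Finset.sum_congr rfl fun i _ => ?_
  congr 1
  change h (formAct f _) = (toConv f * toConv h) _
  rw [(ℛ k _).convMul_apply, formAct_repr]
  simp

variable (k A) in
/-- The action of the linear forms, as a linear map. -/
def formActHom : (A →ₗ[k] k) →ₗ[k] A →ₗ[k] A where
  toFun := formAct
  map_add' f h := by
    ext x
    simp [formAct_repr, add_smul, Finset.sum_add_distrib]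
  map_smul' r f := by
    ext x
    simp [formAct_repr, mul_smul, Finset.smul_sum]

theorem formActHom_apply (f : A →ₗ[k] k) : formActHom k A f = formAct f := rfl

/-- `f(y₁ z₁) y₂ z₂` -/
theorem formAct_mul (f : A →ₗ[k] k) (y z : A) :
    formAct f (y * z) = ∑ i ∈ (ℛ k z).index,
      formAct (f ∘ₗ LinearMap.mulRight k ((ℛ k z).left i)) y * (ℛ k z).right i := by
  rw [formAct, LinearMap.comp_apply, LinearMap.comp_apply, Bialgebra.comul_mul, ← (ℛ k z).eq,
    Finset.mul_sum, map_sum, map_sum]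
  refine Finset.sum_congr rfl fun i _ => ?_
  rw [formAct_repr, ← (ℛ k y).eq, Finset.sum_mul, map_sum, map_sum, Finset.sum_mul]
  simp

section Basis

variable {ι : Type*} [Fintype ι] (b : Module.Basis ι k A)

theorem Module.Basis.sum_coord_smul_map {V M : Type*} [AddCommGroup V] [Module k V]
    [AddCommGroup M] [Module k M] (b : Module.Basis ι k V) (F : V →ₗ[k] M) (v : V) :
    ∑ i, b.coord i v • F (b i) = F v := by
  conv_rhs => rw [← b.sum_repr v, map_sum]
  simp only [map_smul, Module.Basis.coord_apply]

/-- Cyclicity of the contraction of a pair of dual bases. -/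
theorem Module.Basis.sum_coord_comp {V M : Type*} [AddCommGroup V] [Module k V] [AddCommGroup M]
    [Module k M] (b : Module.Basis ι k V) (B : (V →ₗ[k] k) →ₗ[k] V →ₗ[k] M) (T : V →ₗ[k] V) :
    ∑ i, B (b.coord i ∘ₗ T) (b i) = ∑ i, B (b.coord i) (T (b i)) := by
  classical
  have h₁ : ∀ i, b.coord i ∘ₗ T = ∑ j, b.coord i (T (b j)) • b.coord j := fun i =>
    (b.sum_dual_apply_smul_coord (b.coord i ∘ₗ T)).symm
  calc _ = ∑ i, ∑ j, b.coord i (T (b j)) • B (b.coord j) (b i) := by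
        refine Finset.sum_congr rfl fun i _ => ?_
        rw [h₁ i]
        simp
    _ = ∑ j, ∑ i, b.coord i (T (b j)) • B (b.coord j) (b i) := Finset.sum_comm
    _ = _ := Finset.sum_congr rfl fun j _ => b.sum_coord_smul_map (B (b.coord j)) (T (b j))

theorem Module.Basis.sum_coord_eq_sum_coord {κ V M : Type*} [Fintype κ] [AddCommGroup V]
    [Module k V] [AddCommGroup M] [Module k M] (b : Module.Basis ι k V) (b' : Module.Basis κ k V)
    (B : (V →ₗ[k] k) →ₗ[k] V →ₗ[k] M) :
    ∑ i, B (b.coord i) (b i) = ∑ j, B (b'.coord j) (b' j) := by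
  calc _ = ∑ i, ∑ j, b'.coord j (b i) • B (b.coord i) (b' j) :=
        Finset.sum_congr rfl fun i _ => (b'.sum_coord_smul_map (B (b.coord i)) (b i)).symm
    _ = ∑ j, ∑ i, b'.coord j (b i) • B (b.coord i) (b' j) := Finset.sum_comm
    _ = _ := by
        refine Finset.sum_congr rfl fun j _ => ?_
        conv_rhs => rw [← b.sum_dual_apply_smul_coord (b'.coord j)]
        simp only [map_sum, map_smul, LinearMap.sum_apply, LinearMap.smul_apply]

/-- The element `∑ e^i(S²(x₁ e_i₁) u) x₂ e_i₂`, as a linear function of `u`. -/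
def cointegralAux (x : A) : A →ₗ[k] A :=
  ∑ i, (formActHom k A).flip (x * b i) ∘ₗ
    LinearMap.lcomp k k (antipode k ∘ₗ antipode k) ∘ₗ (LinearMap.llcomp k A A k (b.coord i)) ∘ₗ
      (LinearMap.mul k A).flip

theorem cointegralAux_apply (x u : A) : cointegralAux b x u =
    ∑ i, formAct (b.coord i ∘ₗ LinearMap.mulRight k u ∘ₗ antipode k ∘ₗ antipode k) (x * b i) := by
  simp only [cointegralAux, LinearMap.sum_apply]
  rfl

/-- Cyclicity of the trace moves right multiplication by `y` from `e^i` to `e_i`; expanding the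
coproduct of `x e_i y` then yields `S²(y₁)` inside the form and `y₂` outside. -/
theorem cointegralAux_mul (x u y : A) : cointegralAux b x (u * y) = ∑ i ∈ (ℛ k y).index,
    cointegralAux b x (antipode k (antipode k ((ℛ k y).left i)) * u) * (ℛ k y).right i := by
  let B : (A →ₗ[k] k) →ₗ[k] A →ₗ[k] A := LinearMap.flip
    ((formActHom k A ∘ₗ LinearMap.lcomp k k
      (LinearMap.mulRight k u ∘ₗ antipode k ∘ₗ antipode k)).flip ∘ₗ LinearMap.mulLeft k x)
  have h := b.sum_coord_comp B (LinearMap.mulRight k y)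
  have h₁ : cointegralAux b x (u * y) = ∑ i, B (b.coord i ∘ₗ LinearMap.mulRight k y) (b i) := by
    rw [cointegralAux_apply]
    refine Finset.sum_congr rfl fun i _ => ?_
    refine LinearMap.congr_fun (f := formAct _) (g := formAct _) (congrArg formAct ?_) _
    exact (LinearMap.ext fun z => by simp [mul_assoc])
  have h₂ : ∀ i, B (b.coord i) (b i * y) = formAct (b.coord i ∘ₗ LinearMap.mulRight k u ∘ₗ
      antipode k ∘ₗ antipode k) (x * b i * y) := fun i => by rw [mul_assoc]; rfl
  rw [h₁, h]
  simp only [LinearMap.mulRight_apply, h₂, formAct_mul _ _ y]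
  rw [Finset.sum_comm]
  refine Finset.sum_congr rfl fun j _ => ?_
  rw [cointegralAux_apply, Finset.sum_mul]
  refine Finset.sum_congr rfl fun i _ => ?_
  refine congrArg (· * _) (LinearMap.congr_fun (congrArg formAct (LinearMap.ext fun z => ?_)) _)
  simp [antipode_mul_antidistrib, mul_assoc]

/-- `cointegralAux b x 1` is a right cointegral. -/
theorem cointegralAux_one_mul (x y : A) :
    cointegralAux b x 1 * y = counit (R := k) y • cointegralAux b x 1 := by
  -- Write `F` for the map `cointegralAux b x` and evaluate `F(S(y₁) y₂)` twice: it is `ε(y) F(1)`,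
  -- and by `cointegralAux_mul` it is `F(S²(y₂) S(y₁)) y₃ = F(S(y₁ S(y₂))) y₃ = F(1) y`.
  have h := congrArg (cointegralAux b x) (sum_antipode_mul_eq_smul (ℛ k y))
  rw [map_smul, map_sum] at h
  rw [← h]
  let F : A ⊗[k] A →ₗ[k] A := LinearMap.mul' k A ∘ₗ
    TensorProduct.map (cointegralAux b x ∘ₗ antipode k) LinearMap.id
  have h' := congrArg F (sum_tmul_one_mul_map_antipode (k := k) y)
  rw [map_sum] at h'
  have h₁ : F (1 ⊗ₜ[k] y) = cointegralAux b x 1 * y := by simp [F]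
  rw [← h₁, ← h']
  refine Finset.sum_congr rfl fun i _ => ?_
  rw [cointegralAux_mul, ← (ℛ k ((ℛ k y).right i)).eq]
  simp [F, Finset.mul_sum, antipode_mul_antidistrib]

/-- If all these cointegrals vanished, so would the sum over `j` of the actions of `e^j ∘ S` on
those with `x = e_j`; but this sum equals `1`. -/
theorem exists_cointegralAux_ne_zero : ∃ x : A, cointegralAux b x 1 ≠ 0 := by
  classical
  by_contra! h
  let q (i j : ι) : WithConv (A →ₗ[k] k) :=
    toConv (b.coord i ∘ₗ antipode k ∘ₗ antipode k) * toConv (b.coord j ∘ₗ antipode k)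
  have h₁ : ∑ j, formAct (b.coord j ∘ₗ antipode k) (cointegralAux b (b j) 1) =
      ∑ j, ∑ i, formAct (q i j).ofConv (b j * b i) := by
    refine Finset.sum_congr rfl fun j _ => ?_
    rw [cointegralAux_apply, map_sum]
    refine Finset.sum_congr rfl fun i _ => ?_
    rw [formAct_formAct, LinearMap.mulRight_one, LinearMap.id_comp]
  -- The left side is `S(y₂) S²(y₁) = S(S(y₁) y₂)`.
  have h₂ : ∀ y : A, ∑ j, ∑ i, q i j y • (b j * b i) = counit (R := k) y • (1 : A) := by
    intro y
    have h₃ : ∀ u v : A, ∑ j, ∑ i, (b.coord i v * b.coord j u) • (b j * b i) = u * v := by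
      intro u v
      conv_rhs => rw [← b.sum_repr u, ← b.sum_repr v, Finset.sum_mul_sum]
      refine Finset.sum_congr rfl fun j _ => Finset.sum_congr rfl fun i _ => ?_
      rw [smul_mul_smul_comm, mul_comm]
      rfl
    have h₄ := congrArg (antipode k) (sum_antipode_mul_eq_smul (ℛ k y))
    rw [map_sum, map_smul, antipode_one] at h₄
    rw [← h₄]
    have h₅ : ∀ i j, q i j y = ∑ m ∈ (ℛ k y).index,
        b.coord i (antipode k (antipode k ((ℛ k y).left m))) *
          b.coord j (antipode k ((ℛ k y).right m)) := fun i j => (ℛ k y).convMul_apply _ _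
    simp only [antipode_mul_antidistrib, h₅, Finset.sum_smul]
    rw [Finset.sum_congr rfl fun j _ => Finset.sum_comm, Finset.sum_comm]
    exact Finset.sum_congr rfl fun m _ => h₃ _ _
  have h₅ : ∑ j, ∑ i, formAct (q i j).ofConv (b j * b i) = 1 := by
    have h₆ : ∀ i j, formAct (q i j).ofConv (b j * b i) =
        ∑ m, formAct (b.coord m) (q i j (b m) • (b j * b i)) := by
      intro i j
      have h₇ := congrArg (fun f => formActHom k A f (b j * b i))
        (b.sum_dual_apply_smul_coord (q i j).ofConv)
      simp only [map_sum, map_smul, LinearMap.sum_apply, LinearMap.smul_apply,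
        formActHom_apply] at h₇
      simp only [map_smul]
      exact h₇.symm
    simp only [h₆]
    rw [Finset.sum_congr rfl fun j _ => Finset.sum_comm, Finset.sum_comm]
    simp only [← map_sum, h₂]
    have h₇ := congrArg (fun f => formActHom k A f 1)
      (b.sum_dual_apply_smul_coord (counit (R := k)))
    simp only [map_sum, map_smul, LinearMap.sum_apply, LinearMap.smul_apply,
      formActHom_apply] at h₇
    simp only [map_smul]
    refine h₇.trans ?_
    rw [formAct_repr, sum_counit_smul]
  refine one_ne_zero (α := k) ?_
  have h₇ : (1 : A) = 0 := by
    rw [← h₅, ← h₁]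
    simp [h]
  rw [← Bialgebra.counit_one (R := k) (A := A), h₇, map_zero]

/-- The linear form `a ↦ ∑ f(g e_i₁ g⁻¹ a₁) e^i(g e_i₂ g⁻¹ a₂)`. -/
def integralAux (g : Pivot k A) (f : A →ₗ[k] k) : A →ₗ[k] k :=
  ∑ i, b.coord i ∘ₗ formAct f ∘ₗ
    LinearMap.mulLeft k ((g.val : A) * b i * ((g.val⁻¹ : Aˣ) : A))

/-- Conjugation by `g` is `S²`, so this is the image of `sum_map_antipode_mul_one_tmul` under `S² ⊗
S`. -/
theorem sum_one_tmul_antipode_mul_comul (g : Pivot k A) (y : A) :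
    ∑ i ∈ (ℛ k y).index, ((1 : A) ⊗ₜ[k] antipode k ((ℛ k y).right i)) *
      comul (R := k) ((g.val : A) * (ℛ k y).left i * ((g.val⁻¹ : Aˣ) : A)) =
      ((g.val : A) * y * ((g.val⁻¹ : Aˣ) : A)) ⊗ₜ[k] 1 := by
  let F : A ⊗[k] A →ₗ[k] A ⊗[k] A := TensorProduct.map
    (LinearMap.mulRight k ((g.val⁻¹ : Aˣ) : A) ∘ₗ LinearMap.mulLeft k (g.val : A)) (antipode k)
  have h := congrArg F (sum_map_antipode_mul_one_tmul (k := k) y)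
  rw [map_sum] at h
  have h₁ : F (y ⊗ₜ[k] 1) = ((g.val : A) * y * ((g.val⁻¹ : Aˣ) : A)) ⊗ₜ[k] 1 := by simp [F]
  rw [← h₁, ← h]
  refine Finset.sum_congr rfl fun i _ => ?_
  rw [Bialgebra.comul_mul, Bialgebra.comul_mul, g.isGroupLike.comul_eq_tmul_self,
    g.isGroupLike_inv.comul_eq_tmul_self, ← (ℛ k ((ℛ k y).left i)).eq]
  simp [F, Finset.mul_sum, Finset.sum_mul, antipode_mul_antidistrib, g.antipode_antipode, mul_assoc]

theorem sum_formAct_tmul (g : Pivot k A) (f : A →ₗ[k] k) (a y : A) :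
    ∑ i ∈ (ℛ k a).index, formAct f ((g.val : A) * y * ((g.val⁻¹ : Aˣ) : A) * (ℛ k a).left i) ⊗ₜ[k]
      (ℛ k a).right i = ∑ i ∈ (ℛ k y).index, ((1 : A) ⊗ₜ[k] antipode k ((ℛ k y).right i)) *
        comul (R := k) (formAct f ((g.val : A) * (ℛ k y).left i * ((g.val⁻¹ : Aˣ) : A) * a)) := by
  have h := congrArg (fun z => TensorProduct.map (formAct f) LinearMap.id (z * comul a))
    (sum_one_tmul_antipode_mul_comul g y)
  simp only [Finset.sum_mul, mul_assoc _ _ (comul (R := k) a), ← Bialgebra.comul_mul] at h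
  have h₁ : ∀ (s : A) (z : A ⊗[k] A), TensorProduct.map (formAct f) LinearMap.id
      (((1 : A) ⊗ₜ[k] s) * z) = ((1 : A) ⊗ₜ[k] s) *
        TensorProduct.map (formAct f) LinearMap.id z := by
    intro s z
    induction z with
    | zero => simp
    | add x y hx hy => simp only [mul_add, map_add, hx, hy]
    | tmul x y => simp
  simp only [map_sum, h₁, ← comul_formAct] at h
  rw [h]
  conv_rhs => rw [← (ℛ k a).eq]
  simp [Finset.mul_sum]

/-- The value at `a` is the trace of `T : y ↦ f(S²(y)₁ a₁) S²(y)₂ a₂`. By `sum_formAct_tmul`,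
replacing `a` by `a₁` and keeping `a₂` outside inserts a factor `S(y₂)`; under the trace it meets
the second leg of the coproduct of a basis vector and cancels by the antipode axiom. -/
theorem isRightIntegral_integralAux (g : Pivot k A) (f : A →ₗ[k] k) :
    IsRightIntegral (integralAux b g f) := by
  classical
  intro a
  let T : A →ₗ[k] A := formAct f ∘ₗ LinearMap.mulRight k (((g.val⁻¹ : Aˣ) : A) * a) ∘ₗ
    LinearMap.mulLeft k (g.val : A)
  have hT : ∀ y, T y = formAct f ((g.val : A) * y * ((g.val⁻¹ : Aˣ) : A) * a) := fun y => by
    simp [T, mul_assoc]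
  let G (j : ι) : WithConv (A →ₗ[k] A) :=
    toConv ((b.coord j ∘ₗ T).smulRight (1 : A)) * toConv (antipode k)
  have hG : ∀ j y, G j y = ∑ i ∈ (ℛ k y).index,
      b.coord j (T ((ℛ k y).left i)) • antipode k ((ℛ k y).right i) := fun j y => by
    rw [(ℛ k y).convMul_apply]
    simp
  have h₁ : ∀ i, ∑ m ∈ (ℛ k a).index, b.coord i (formAct f ((g.val : A) * b i *
      ((g.val⁻¹ : Aˣ) : A) * (ℛ k a).left m)) • (ℛ k a).right m =
      ∑ j, G j (b i) * formAct (b.coord i) (b j) := by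
    intro i
    have h := congrArg (fun z => TensorProduct.lid k A ((b.coord i).rTensor A z))
      (sum_formAct_tmul g f a (b i))
    simp only [map_sum, LinearMap.rTensor_tmul, TensorProduct.lid_tmul, ← hT] at h
    rw [h]
    have h₂ : ∀ s z : A, TensorProduct.lid k A ((b.coord i).rTensor A
        (((1 : A) ⊗ₜ[k] s) * comul z)) = ∑ j, b.coord j z • (s * formAct (b.coord i) (b j)) := by
      intro s z
      have h₃ : ∀ w : A ⊗[k] A, TensorProduct.lid k A ((b.coord i).rTensor A
        (((1 : A) ⊗ₜ[k] s) * w)) = s * TensorProduct.lid k A ((b.coord i).rTensor A w) := by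
        intro w
        induction w with
        | zero => simp
        | add x y hx hy => simp only [mul_add, map_add, hx, hy]
        | tmul x y => simp
      rw [h₃]
      change s * formAct (b.coord i) z = _
      exact (b.sum_coord_smul_map (LinearMap.mulLeft k s ∘ₗ formAct (b.coord i)) z).symm
    simp only [h₂, hG, Finset.sum_mul, smul_mul_assoc]
    exact Finset.sum_comm
  -- Summing over the dual bases gives `G_j((b_j)₁) (b_j)₂`, the convolution of `G_j` with the
  -- identity, which undoes the factor `S` in `G_j`.
  have h₄ : ∀ j, ∑ i, G j (b i) * formAct (b.coord i) (b j) = b.coord j (T (b j)) • (1 : A) := by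
    intro j
    have h₅ : G j * toConv LinearMap.id = toConv ((b.coord j ∘ₗ T).smulRight (1 : A)) := by
      rw [mul_assoc, LinearMap.antipode_mul_id, mul_one]
    have h₆ := congrArg (fun F : WithConv (A →ₗ[k] A) => F (b j)) h₅
    simp only [(ℛ k (b j)).convMul_apply] at h₆
    refine Eq.trans ?_ h₆
    simp only [formAct_repr, Finset.mul_sum]
    rw [Finset.sum_comm]
    refine Finset.sum_congr rfl fun m _ => ?_
    simp only [mul_smul_comm]
    exact b.sum_coord_smul_map (LinearMap.mulRight k _ ∘ₗ (G j).ofConv) _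
  change formAct (integralAux b g f) a = _
  rw [formAct_repr]
  simp only [integralAux, LinearMap.sum_apply, Finset.sum_smul, LinearMap.comp_apply,
    LinearMap.mulLeft_apply]
  rw [Finset.sum_comm]
  simp only [h₁]
  rw [Finset.sum_comm]
  simp only [h₄, hT]

/-- The cointegral turns multiplication by `g e_i g⁻¹` into the scalar `ε(e_i)`, and `∑ ε(e_i) e^i =
ε`; what remains is `ε(f(c₁) c₂) = f(c)`. Hence a normalized `f` gives a normalized integral. -/
theorem integralAux_cointegral (g : Pivot k A) (f : A →ₗ[k] k) {c : A}
    (hc : IsLeftCointegral k c) : integralAux b g f c = f c := by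
  have h : ∀ y : A, counit (R := k) ((g.val : A) * y * ((g.val⁻¹ : Aˣ) : A)) =
      counit (R := k) y := by
    intro y
    simp [g.isGroupLike.counit_eq_one, g.isGroupLike_inv.counit_eq_one]
  simp only [integralAux, LinearMap.sum_apply, LinearMap.comp_apply, LinearMap.mulLeft_apply,
    hc _, h, map_smul]
  have h₁ : ∑ i, counit (R := k) (b i) • b.coord i = counit := b.sum_dual_apply_smul_coord _
  have h₂ := LinearMap.congr_fun h₁ (formAct f c)
  simp only [LinearMap.sum_apply, LinearMap.smul_apply] at h₂
  refine h₂.trans ?_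
  have h₃ := congrArg (fun z => f (TensorProduct.rid k A z)) (sum_tmul_counit_eq (ℛ k c))
  rw [formAct_repr, map_sum]
  simp only [map_sum, TensorProduct.rid_tmul, map_smul, one_smul, smul_eq_mul] at h₃
  simpa [mul_comm] using h₃

end Basis

theorem exists_isIntegralPair [Module.Finite k A] (g : Pivot k A) :
    ∃ (l : A →ₗ[k] k) (c : A), IsIntegralPair l c := by
  let b := Module.Basis.ofVectorSpace k A
  obtain ⟨x, hx⟩ := exists_cointegralAux_ne_zero b
  have hc : IsLeftCointegral k (antipode k (cointegralAux b x 1)) := by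
    intro y
    obtain ⟨z, rfl⟩ : ∃ z, antipode k z = y := ⟨_, g.antipode_antipodeInv y⟩
    rw [← antipode_mul_antidistrib, cointegralAux_one_mul, map_smul, counit_antipode]
  have hc' : antipode k (cointegralAux b x 1) ≠ 0 := fun h =>
    hx (g.antipode_injective (h.trans (map_zero _).symm))
  obtain ⟨f, hf⟩ := Module.Projective.exists_dual_eq_one k hc'
  exact ⟨_, _, isRightIntegral_integralAux b g f, hc, (integralAux_cointegral b g f hc).trans hf⟩

end IntegralExistence

/-! ### Extending a cyclic form from a generator to the whole ideal. -/

section TraceExtension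

variable {C : Type u} [Category.{v} C] [Preadditive C]

/-- In substance `P` is a retract of `Qⁿ`; lifting each summand separately avoids the need for
biproducts. -/
theorem projective_of_id_eq_sum {n : ℕ} {P Q : C} [Projective Q] (f : Fin n → (Q ⟶ P))
    (g : Fin n → (P ⟶ Q)) (h : 𝟙 P = ∑ j, g j ≫ f j) : Projective P where
  factors {E X} φ e _ := ⟨∑ j, g j ≫ Projective.factorThru (f j ≫ φ) e, by
    conv_rhs => rw [← Category.id_comp φ, h]
    simp [Preadditive.sum_comp]⟩

variable {k : Type w} [Field k] [Linear k C]

/-- A cyclic linear form on `End G` yields the same value on `q ≫ p` and on `p ≫ q`, whatever the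
decompositions of the identities through `G`. -/
theorem sum_cyclic_form {G U V : C} {T : (G ⟶ G) →ₗ[k] k}
    (hT : ∀ a b : G ⟶ G, T (a ≫ b) = T (b ≫ a)) {n m : ℕ}
    {f : Fin n → (G ⟶ V)} {g : Fin n → (V ⟶ G)} (h : 𝟙 V = ∑ j, g j ≫ f j)
    {f' : Fin m → (G ⟶ U)} {g' : Fin m → (U ⟶ G)} (h' : 𝟙 U = ∑ j, g' j ≫ f' j)
    (q : V ⟶ U) (p : U ⟶ V) :
    ∑ j, T (f j ≫ (q ≫ p) ≫ g j) = ∑ j, T (f' j ≫ (p ≫ q) ≫ g' j) := by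
  have h₁ : ∀ j, T (f j ≫ (q ≫ p) ≫ g j) = ∑ i, T ((f j ≫ q ≫ g' i) ≫ (f' i ≫ p ≫ g j)) := by
    intro j
    rw [← map_sum]
    congr 1
    conv_lhs => rw [← Category.id_comp p, h']
    simp [Preadditive.sum_comp, Preadditive.comp_sum]
  have h₂ : ∀ i, T (f' i ≫ (p ≫ q) ≫ g' i) = ∑ j, T ((f' i ≫ p ≫ g j) ≫ (f j ≫ q ≫ g' i)) := by
    intro i
    rw [← map_sum]
    congr 1
    conv_lhs => rw [← Category.id_comp q, h]
    simp [Preadditive.sum_comp, Preadditive.comp_sum]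
  simp only [h₁, h₂, hT (f _ ≫ _)]
  exact Finset.sum_comm

variable {I : ObjectProperty C}

/-- The extension to an ideal of a linear form on the endomorphisms of a generator. -/
noncomputable def extendTrace {G : C} (hG : IsIdealGenerator I G) (T : (G ⟶ G) →ₗ[k] k) :
    TraceFamily k I := fun V hV =>
  ∑ j, T ∘ₗ Linear.leftComp k G ((hG.2 V hV).choose_spec.choose j) ∘ₗ
    Linear.rightComp k V ((hG.2 V hV).choose_spec.choose_spec.choose j)

/-- Independence of the chosen decomposition: `sum_cyclic_form` between two decompositions of the
same object, with `p` the identity. -/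
theorem extendTrace_eq {G : C} (hG : IsIdealGenerator I G) {T : (G ⟶ G) →ₗ[k] k}
    (hT : ∀ a b : G ⟶ G, T (a ≫ b) = T (b ≫ a)) {V : C} (hV : I V) {n : ℕ}
    {f : Fin n → (G ⟶ V)} {g : Fin n → (V ⟶ G)} (h : 𝟙 V = ∑ j, g j ≫ f j) (φ : V ⟶ V) :
    extendTrace hG T V hV φ = ∑ j, T (f j ≫ φ ≫ g j) := by
  have h₁ := sum_cyclic_form hT (hG.2 V hV).choose_spec.choose_spec.choose_spec h φ (𝟙 V)
  rw [Category.comp_id, Category.id_comp] at h₁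
  rw [← h₁, extendTrace, LinearMap.sum_apply]
  rfl

theorem extendTrace_generator {G : C} (hG : IsIdealGenerator I G) {T : (G ⟶ G) →ₗ[k] k}
    (hT : ∀ a b : G ⟶ G, T (a ≫ b) = T (b ≫ a)) (hG' : I G) (φ : G ⟶ G) :
    extendTrace hG T G hG' φ = T φ := by
  rw [extendTrace_eq hG hT hG' (n := 1) (f := fun _ => 𝟙 G) (g := fun _ => 𝟙 G) (by simp)]
  simp

theorem extendTrace_isCyclic {G : C} (hG : IsIdealGenerator I G) {T : (G ⟶ G) →ₗ[k] k}
    (hT : ∀ a b : G ⟶ G, T (a ≫ b) = T (b ≫ a)) : (extendTrace hG T).IsCyclic := by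
  intro U V hU hV f g
  obtain ⟨n, a, b, h⟩ := hG.2 U hU
  obtain ⟨m, a', b', h'⟩ := hG.2 V hV
  rw [extendTrace_eq hG hT hV h', extendTrace_eq hG hT hU h]
  exact sum_cyclic_form hT h' h f g

end TraceExtension

/-! ### Free modules, and the regular module as a generator of the projective objects. -/

noncomputable section FreeModules

namespace FDMod

variable {k A : Type u} [Field k] [Ring A]

section Algebra

variable [Algebra k A]

@[simp]
theorem sum_hom {M N : FDMod k A} {ι : Type*} (s : Finset ι) (f : ι → (M ⟶ N)) :
    Hom.hom (∑ i ∈ s, f i : M ⟶ N) = ∑ i ∈ s, (f i).hom :=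
  map_sum ({ toFun := fun f => f.hom, map_zero' := rfl, map_add' := fun _ _ => rfl } :
    (M ⟶ N) →+ (M.V →ₗ[k] N.V)) f s

@[simp]
theorem zero_hom {M N : FDMod k A} : Hom.hom (0 : M ⟶ N) = 0 := rfl

theorem hom_comp_apply {M N P : FDMod k A} (f : M ⟶ N) (g : N ⟶ P) (x : M.V) :
    (f ≫ g).hom x = g.hom (f.hom x) := rfl

theorem ρ_mul (M : FDMod k A) (a b : A) (m : M.V) : M.ρ (a * b) m = M.ρ a (M.ρ b m) := by
  rw [map_mul]; rfl

theorem ρ_one (M : FDMod k A) (m : M.V) : M.ρ 1 m = m := by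
  rw [map_one]; rfl

theorem hom_apply_ρ {M N : FDMod k A} (f : M ⟶ N) (a : A) (m : M.V) :
    f.hom (M.ρ a m) = N.ρ a (f.hom m) := LinearMap.congr_fun (f.comm a) m

/-- The quotient of a module by the range of a morphism. -/
def coker {M N : FDMod k A} (f : M ⟶ N) : FDMod k A where
  V := N.V ⧸ LinearMap.range f.hom
  ρ := AlgHom.ofLinearMap
    { toFun := fun a => (LinearMap.range f.hom).mapQ (LinearMap.range f.hom) (N.ρ a) (by
        rintro _ ⟨m, rfl⟩
        exact ⟨M.ρ a m, hom_apply_ρ f a m⟩)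
      map_add' := fun a b => by
        refine LinearMap.ext fun x => ?_
        obtain ⟨x, rfl⟩ := Submodule.mkQ_surjective _ x
        simp
      map_smul' := fun c a => by
        refine LinearMap.ext fun x => ?_
        obtain ⟨x, rfl⟩ := Submodule.mkQ_surjective _ x
        simp }
    (by
      refine LinearMap.ext fun x => ?_
      obtain ⟨x, rfl⟩ := Submodule.mkQ_surjective _ x
      simp)
    (fun a b => by
      refine LinearMap.ext fun x => ?_
      obtain ⟨x, rfl⟩ := Submodule.mkQ_surjective _ x
      simp)

/-- The projection to the cokernel is killed by an epimorphism, so the cokernel vanishes. -/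
theorem surjective_of_epi {M N : FDMod k A} (f : M ⟶ N) [Epi f] :
    Function.Surjective f.hom := by
  let π : N ⟶ coker f := ⟨(LinearMap.range f.hom).mkQ, fun a => rfl⟩
  have h : π = 0 := by
    rw [← cancel_epi f]
    refine hom_ext (LinearMap.ext fun x => ?_)
    exact (Submodule.Quotient.mk_eq_zero _).2 ⟨x, rfl⟩
  intro y
  have h' : (LinearMap.range f.hom).mkQ y = 0 := congrArg (fun q : N ⟶ coker f => q.hom y) h
  exact (Submodule.Quotient.mk_eq_zero _).1 h'

theorem epi_of_surjective {M N : FDMod k A} (f : M ⟶ N) (hf : Function.Surjective f.hom) :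
    Epi f where
  left_cancellation u v h := by
    refine hom_ext (LinearMap.ext fun y => ?_)
    obtain ⟨x, rfl⟩ := hf y
    exact congrArg (fun q => Hom.hom q x) h

/-- Equality of dimensions spares the check that `s` is also a left inverse; its `A`-linearity
follows from the injectivity of `f`. -/
theorem exists_iso_of_rightInverse {M N : FDMod k A} (f : M ⟶ N) (s : N.V →ₗ[k] M.V)
    (h : ∀ x, f.hom (s x) = x) (hd : Module.finrank k M.V = Module.finrank k N.V) :
    ∃ e : M ≅ N, e.hom = f ∧ ∀ x, e.inv.hom x = s x := by
  have hs : Function.Surjective f.hom := fun x => ⟨s x, h x⟩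
  have hi : Function.Injective f.hom :=
    (LinearMap.injective_iff_surjective_of_finrank_eq_finrank hd).2 hs
  let t : N ⟶ M := ⟨s, fun a => LinearMap.ext fun x => hi (by
    rw [LinearMap.comp_apply, LinearMap.comp_apply, h, hom_apply_ρ, h])⟩
  exact ⟨⟨f, t, hom_ext (LinearMap.ext fun x => hi (h _)), hom_ext (LinearMap.ext h)⟩, rfl,
    fun _ => rfl⟩

variable [Module.Finite k A]

theorem ofElem_apply (M : FDMod k A) (m : M.V) (a : A) : (ofElem M m).hom a = M.ρ a m := rfl

theorem regular_hom_ext {M : FDMod k A} {f h : regular k A ⟶ M}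
    (e : f.hom (1 : A) = h.hom (1 : A)) : f = h := by
  refine hom_ext (LinearMap.ext fun (a : A) => ?_)
  have h₁ : (regular k A).ρ a (1 : A) = a := mul_one a
  rw [← h₁, hom_apply_ρ, hom_apply_ρ, e]

instance regular_projective : Projective (regular k A) where
  factors {E X} f e _ := by
    obtain ⟨y, hy⟩ := surjective_of_epi e (f.hom (1 : A))
    refine ⟨ofElem E y, regular_hom_ext ?_⟩
    rw [hom_comp_apply, ofElem_apply, ρ_one, hy]

variable (k A) in
/-- The free module on a vector space. -/
abbrev free (V : Type u) [AddCommGroup V] [Module k V] [Module.Finite k V] : FDMod k A where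
  V := A ⊗[k] V
  ρ := AlgHom.ofLinearMap (LinearMap.rTensorHom V ∘ₗ (Algebra.lmul k A).toLinearMap)
    (by ext; simp) (fun a b => by ext; simp [mul_assoc])

variable {V : Type u} [AddCommGroup V] [Module k V] [Module.Finite k V]

/-- The extension of a linear map to a morphism from the free module. -/
def freeLift {M : FDMod k A} (φ : V →ₗ[k] M.V) : free k A V ⟶ M where
  hom := TensorProduct.lift (LinearMap.lcomp k M.V φ ∘ₗ M.ρ.toLinearMap)
  comm a := TensorProduct.ext' fun (b : A) v => ρ_mul M a b (φ v)

theorem freeLift_tmul {M : FDMod k A} (φ : V →ₗ[k] M.V) (a : A) (v : V) :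
    (freeLift φ).hom (a ⊗ₜ[k] v) = M.ρ a (φ v) := rfl

/-- The inclusion of the summand of a free module generated by a vector. -/
def freeIncl (v : V) : regular k A ⟶ free k A V := ofElem (free k A V) ((1 : A) ⊗ₜ[k] v)

theorem freeIncl_apply (v : V) (a : A) : (freeIncl v).hom a = a ⊗ₜ[k] v := by
  change (a * 1) ⊗ₜ[k] v = _
  rw [mul_one]

/-- The morphism from a free module to the regular module given by a linear form. -/
def freeCoord (φ : V →ₗ[k] k) : free k A V ⟶ regular k A where
  hom := (TensorProduct.rid k A).toLinearMap ∘ₗ φ.lTensor A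
  comm a := TensorProduct.ext' fun (b : A) v => by
    change φ v • (a * b) = a * (φ v • b)
    rw [mul_smul_comm]

theorem freeCoord_tmul (φ : V →ₗ[k] k) (a : A) (v : V) :
    (freeCoord φ).hom (a ⊗ₜ[k] v) = φ v • a := rfl

theorem free_id_eq_sum {n : ℕ} (b : Module.Basis (Fin n) k V) :
    𝟙 (free k A V) = ∑ i, freeCoord (b.coord i) ≫ freeIncl (b i) := by
  refine hom_ext (TensorProduct.ext' fun (a : A) v => ?_)
  simp only [sum_hom, LinearMap.sum_apply]
  have h := b.sum_repr v
  conv_lhs => rw [← h]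
  simp only [id_hom, LinearMap.id_apply, TensorProduct.tmul_sum, TensorProduct.tmul_smul]
  refine Finset.sum_congr rfl fun i _ => ?_
  change _ = (freeIncl (b i)).hom (b.coord i v • a)
  rw [freeIncl_apply, TensorProduct.smul_tmul']
  rfl

theorem freeIncl_freeCoord {n : ℕ} (b : Module.Basis (Fin n) k V) (i j : Fin n) :
    freeIncl (A := A) (b i) ≫ freeCoord (b.coord j) = if i = j then 𝟙 _ else 0 := by
  refine regular_hom_ext ?_
  rw [hom_comp_apply, freeIncl_apply, freeCoord_tmul]
  split_ifs with h
  · subst h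
    simp
  · simp [h]

/-- A projective module splits off the free module on its underlying space, which is a finite sum of
copies of `A`. -/
theorem exists_id_eq_sum_of_projective (P : FDMod k A) [Projective P] :
    ∃ (n : ℕ) (f : Fin n → (regular k A ⟶ P)) (g : Fin n → (P ⟶ regular k A)),
      𝟙 P = ∑ j, g j ≫ f j := by
  let π : free k A P.V ⟶ P := freeLift LinearMap.id
  have : Epi π := epi_of_surjective π fun x => ⟨(1 : A) ⊗ₜ[k] x, ρ_one P x⟩
  let s : P ⟶ free k A P.V := Projective.factorThru (𝟙 P) π
  let b := Module.finBasis k P.V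
  refine ⟨_, fun i => freeIncl (b i) ≫ π, fun i => s ≫ freeCoord (b.coord i), ?_⟩
  calc 𝟙 P = s ≫ 𝟙 _ ≫ π := by simp [s]
    _ = _ := by simp [free_id_eq_sum b, Preadditive.sum_comp, Preadditive.comp_sum]

theorem regular_isIdealGenerator :
    IsIdealGenerator (isProjective (FDMod k A)) (regular k A) :=
  ⟨regular_projective, fun P (_ : Projective P) => exists_id_eq_sum_of_projective P⟩

end Algebra

end FDMod

end FreeModules

/-! ### Tensor products with the regular module are free. -/

noncomputable section ProjectiveIdeal

namespace FDMod

open Coalgebra HopfAlgebra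

variable {k A : Type u} [Field k] [Ring A] [HopfAlgebra k A]

/-- The linear map `a ⊗ m ↦ a₁ ⊗ S(a₂) m`. -/
def tensorRightInv (M : FDMod k A) : A ⊗[k] M.V →ₗ[k] A ⊗[k] M.V :=
  (TensorProduct.lift (M.ρ.toLinearMap ∘ₗ antipode k)).lTensor A ∘ₗ
    (TensorProduct.assoc k A A M.V).toLinearMap ∘ₗ comul.rTensor M.V

theorem tensorRightInv_tmul (M : FDMod k A) (a : A) (m : M.V) :
    tensorRightInv M (a ⊗ₜ[k] m) = ∑ i ∈ (ℛ k a).index,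
      (ℛ k a).left i ⊗ₜ[k] M.ρ (antipode k ((ℛ k a).right i)) m := by
  simp only [tensorRightInv, LinearMap.comp_apply, LinearMap.rTensor_tmul]
  rw [← (ℛ k a).eq]
  simp [TensorProduct.sum_tmul]

/-- The linear map `m ⊗ a ↦ a₂ ⊗ S⁻¹(a₁) m`. -/
def tensorLeftInv (g : Pivot k A) (M : FDMod k A) : M.V ⊗[k] A →ₗ[k] A ⊗[k] M.V :=
  (TensorProduct.lift (M.ρ.toLinearMap ∘ₗ g.antipodeInv)).lTensor A ∘ₗ
    (TensorProduct.assoc k A A M.V).toLinearMap ∘ₗ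
    ((TensorProduct.comm k A A).toLinearMap ∘ₗ comul).rTensor M.V ∘ₗ
    (TensorProduct.comm k M.V A).toLinearMap

theorem tensorLeftInv_tmul (g : Pivot k A) (M : FDMod k A) (m : M.V) (a : A) :
    tensorLeftInv g M (m ⊗ₜ[k] a) = ∑ i ∈ (ℛ k a).index,
      (ℛ k a).right i ⊗ₜ[k] M.ρ (g.antipodeInv ((ℛ k a).left i)) m := by
  simp only [tensorLeftInv, LinearMap.comp_apply, LinearMap.rTensor_tmul, LinearEquiv.coe_coe,
    TensorProduct.comm_tmul]
  rw [← (ℛ k a).eq]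
  simp [TensorProduct.sum_tmul]

variable [Module.Finite k A]

/-- The isomorphism is `a ⊗ m ↦ a₁ ⊗ a₂ m`, untwisted by the antipode. The explicit inverse is
recorded because it computes the dual-basis sum on `A ⊗ A*`. -/
theorem exists_iso_regular_tensor (M : FDMod k A) : ∃ e : free k A M.V ≅ regular k A ⊗ M,
    e.hom = freeLift (M := regular k A ⊗ M) (TensorProduct.mk k A M.V 1) ∧
      ∀ x, e.inv.hom x = tensorRightInv M x := by
  refine exists_iso_of_rightInverse (M := free k A M.V) (N := regular k A ⊗ M) _ (tensorRightInv M) (fun x => ?_) rfl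
  suffices h : (freeLift (M := regular k A ⊗ M) (TensorProduct.mk k A M.V 1)).hom ∘ₗ
      tensorRightInv M = LinearMap.id from LinearMap.congr_fun h x
  refine TensorProduct.ext' fun a m => ?_
  rw [LinearMap.comp_apply, tensorRightInv_tmul, map_sum]
  have h := congrArg (TensorProduct.map LinearMap.id (M.orb m))
    (sum_comul_mul_one_tmul_antipode (k := k) a)
  rw [map_sum] at h
  refine Eq.trans (Finset.sum_congr rfl fun i _ => ?_) (h.trans ?_)
  · rw [freeLift_tmul]
    refine (tensor_ρ_tmul (regular k A) M _ _ _).trans ?_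
    induction comul (R := k) ((ℛ k a).left i) with
    | zero => simp
    | add x y hx hy => rw [map_add, hx, hy, add_mul, map_add]
    | tmul x y =>
      rw [Algebra.TensorProduct.tmul_mul_tmul]
      change (x * 1) ⊗ₜ[k] M.ρ y (M.ρ _ m) = (x * 1) ⊗ₜ[k] M.ρ (y * _) m
      rw [ρ_mul]
  · change a ⊗ₜ[k] M.ρ 1 m = a ⊗ₜ[k] m
    rw [ρ_one]

/-- The mirror image `a ⊗ m ↦ a₁ m ⊗ a₂`, whose inverse needs `S⁻¹`, hence the pivot. The inverse
enters the computation of the left partial trace. -/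
theorem exists_iso_tensor_regular (g : Pivot k A) (M : FDMod k A) :
    ∃ e : free k A M.V ≅ M ⊗ regular k A,
      e.hom = freeLift (M := M ⊗ regular k A) ((TensorProduct.mk k M.V A).flip 1) ∧
      ∀ x, e.inv.hom x = tensorLeftInv g M x := by
  refine exists_iso_of_rightInverse (M := free k A M.V) (N := M ⊗ regular k A) _ (tensorLeftInv g M) (fun x => ?_)
    (TensorProduct.comm k A M.V).finrank_eq
  suffices h : (freeLift (M := M ⊗ regular k A) ((TensorProduct.mk k M.V A).flip 1)).hom ∘ₗ
      tensorLeftInv g M = LinearMap.id from LinearMap.congr_fun h x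
  refine TensorProduct.ext' fun m a => ?_
  rw [LinearMap.comp_apply, tensorLeftInv_tmul, map_sum]
  have h := congrArg (TensorProduct.map (M.orb m ∘ₗ g.antipodeInv) LinearMap.id)
    (sum_tmul_one_mul_map_antipode (k := k) a)
  rw [map_sum] at h
  refine Eq.trans (Finset.sum_congr rfl fun i _ => ?_) (h.trans ?_)
  · rw [freeLift_tmul]
    refine (tensor_ρ_tmul M (regular k A) _ _ _).trans ?_
    induction comul (R := k) ((ℛ k a).right i) with
    | zero => simp
    | add x y hx hy => rw [map_add, hx, hy, map_add, mul_add, map_add]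
    | tmul x y =>
      rw [TensorProduct.map_tmul, TensorProduct.map_tmul, Algebra.TensorProduct.tmul_mul_tmul]
      change M.ρ x (M.ρ _ m) ⊗ₜ[k] (y * 1) =
        M.ρ (g.antipodeInv (_ * antipode k x)) m ⊗ₜ[k] (1 * y)
      rw [g.antipodeInv_mul, g.antipodeInv_antipode, ρ_mul, one_mul, mul_one]
  · change M.ρ (g.antipodeInv 1) m ⊗ₜ[k] a = m ⊗ₜ[k] a
    rw [g.antipodeInv_one, ρ_one]

theorem iso_free_id_eq_sum {V : Type u} [AddCommGroup V] [Module k V] [Module.Finite k V]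
    {M : FDMod k A} (e : free k A V ≅ M) {n : ℕ} (b : Module.Basis (Fin n) k V) :
    𝟙 M = ∑ i, (e.inv ≫ freeCoord (b.coord i)) ≫ freeIncl (b i) ≫ e.hom := by
  calc 𝟙 M = e.inv ≫ 𝟙 _ ≫ e.hom := by simp
    _ = _ := by rw [free_id_eq_sum b]; simp [Preadditive.sum_comp, Preadditive.comp_sum]

theorem iso_free_incl_coord {V : Type u} [AddCommGroup V] [Module k V] [Module.Finite k V]
    {M : FDMod k A} (e : free k A V ≅ M) {n : ℕ} (b : Module.Basis (Fin n) k V) (i j : Fin n) :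
    (freeIncl (b i) ≫ e.hom) ≫ e.inv ≫ freeCoord (b.coord j) = if i = j then 𝟙 _ else 0 := by
  rw [Category.assoc, e.hom_inv_id_assoc, freeIncl_freeCoord]

theorem projective_of_iso_free {V : Type u} [AddCommGroup V] [Module k V] [Module.Finite k V]
    {M : FDMod k A} (e : free k A V ≅ M) : Projective M :=
  projective_of_id_eq_sum _ _ (iso_free_id_eq_sum e (Module.finBasis k V))

instance regular_tensor_projective (M : FDMod k A) : Projective (regular k A ⊗ M) :=
  projective_of_iso_free (exists_iso_regular_tensor M).choose

theorem tensor_regular_projective (g : Pivot k A) (M : FDMod k A) :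
    Projective (M ⊗ regular k A) :=
  projective_of_iso_free (exists_iso_tensor_regular g M).choose

instance : MonoidalPreadditive (FDMod k A) where
  whiskerLeft_zero := hom_ext (TensorProduct.map_zero_right _)
  zero_whiskerRight := hom_ext (TensorProduct.map_zero_left _)
  whiskerLeft_add _ _ := hom_ext (TensorProduct.map_add_right _ _ _)
  add_whiskerRight _ _ := hom_ext (TensorProduct.map_add_left _ _ _)

theorem isTensorIdeal_isProjective (g : Pivot k A) :
    IsTensorIdeal (isProjective (FDMod k A)) where
  tensor_right V W (hV : Projective V) := by
    obtain ⟨n, f, h, e⟩ := exists_id_eq_sum_of_projective V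
    refine projective_of_id_eq_sum (fun j => f j ▷ W) (fun j => h j ▷ W) ?_
    rw [← id_whiskerRight, e, sum_whiskerRight]
    simp
  tensor_left V W (hV : Projective V) := by
    have := tensor_regular_projective g W
    obtain ⟨n, f, h, e⟩ := exists_id_eq_sum_of_projective V
    refine projective_of_id_eq_sum (fun j => W ◁ f j) (fun j => W ◁ h j) ?_
    rw [← whiskerLeft_id, e, whiskerLeft_sum]
    simp
  retract V W f h e (hV : Projective V) :=
    projective_of_id_eq_sum (n := 1) (fun _ => h) (fun _ => f) (by simp [e])

end FDMod

end ProjectiveIdeal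

/-! ### The left modified trace given by the symmetrized integral. -/

noncomputable section LeftTrace

namespace FDMod

open Coalgebra HopfAlgebra

variable {k A : Type u} [Field k] [Ring A] [HopfAlgebra k A]

/-- The contraction of the first tensor factor with a linear form. -/
def contract {V : Type u} [AddCommGroup V] [Module k V] (U : Type u) [AddCommGroup U] [Module k U]
    (φ : V →ₗ[k] k) : V ⊗[k] U →ₗ[k] U :=
  (TensorProduct.lid k U).toLinearMap ∘ₗ φ.rTensor U

section Contract

variable {V U U' : Type u} [AddCommGroup V] [Module k V] [AddCommGroup U] [Module k U]
  [AddCommGroup U'] [Module k U']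

theorem contract_tmul (φ : V →ₗ[k] k) (v : V) (u : U) :
    contract U φ (v ⊗ₜ[k] u) = φ v • u := rfl

theorem lid_map_contractLeft (φ : V →ₗ[k] k) (z : V ⊗[k] U) :
    TensorProduct.lid k U (TensorProduct.map (contractLeft k V) LinearMap.id
      ((TensorProduct.assoc k (Module.Dual k V) V U).symm (φ ⊗ₜ[k] z))) = contract U φ z := by
  induction z with
  | zero => simp
  | add x y hx hy => simp only [TensorProduct.tmul_add, map_add, hx, hy]
  | tmul x y => rfl

theorem contract_map (φ : V →ₗ[k] k) (b : U →ₗ[k] U') (z : V ⊗[k] U) :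
    contract U' φ (TensorProduct.map LinearMap.id b z) = b (contract U φ z) := by
  induction z with
  | zero => simp
  | add x y hx hy => simp only [map_add, hx, hy]
  | tmul x y => simp [contract_tmul]

theorem form_contract (φ : V →ₗ[k] k) (τ : U →ₗ[k] k) (z : V ⊗[k] U) :
    τ (contract U φ z) = φ (TensorProduct.rid k V (τ.lTensor V z)) := by
  induction z with
  | zero => simp
  | add x y hx hy => simp only [map_add, hx, hy]
  | tmul x y => simp [contract_tmul, mul_comm]

end Contract

theorem leftPartialTrace_apply (g : Pivot k A) {U W : FDMod k A} (f : W ⊗ U ⟶ W ⊗ U) (u : U.V) :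
    (leftPartialTrace (pivotal g) f).hom u = ∑ i,
      contract U.V ((Module.Basis.ofVectorSpace k W.V).coord i) (f.hom
        (W.ρ ((g.val⁻¹ : Aˣ) : A) (Module.Basis.ofVectorSpace k W.V i) ⊗ₜ[k] u)) := by
  change TensorProduct.lid k U.V (TensorProduct.map (contractLeft k W.V) LinearMap.id
    ((TensorProduct.assoc k (Module.Dual k W.V) W.V U.V).symm
      (TensorProduct.map LinearMap.id f.hom (TensorProduct.assoc k (Module.Dual k W.V) W.V U.V
        ((TensorProduct.comm k W.V (Module.Dual k W.V)
        (TensorProduct.map (W.ρ ((g.val⁻¹ : Aˣ) : A)) LinearMap.id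
          (coevaluation k W.V 1))) ⊗ₜ[k] u))))) = _
  rw [coevaluation_apply_one]
  simp only [TensorProduct.sum_tmul, map_sum, TensorProduct.assoc_tmul, TensorProduct.comm_tmul,
    TensorProduct.map_tmul, LinearMap.id_apply]
  refine Finset.sum_congr rfl fun i _ => ?_
  exact lid_map_contractLeft _ _

theorem leftPartialTrace_whiskerLeft (g : Pivot k A) {U U' W : FDMod k A} (f : W ⊗ U ⟶ W ⊗ U)
    (a : U' ⟶ U) (b : U ⟶ U') :
    leftPartialTrace (pivotal g) (W ◁ a ≫ f ≫ W ◁ b) = a ≫ leftPartialTrace (pivotal g) f ≫ b := by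
  refine hom_ext (LinearMap.ext fun u => ?_)
  rw [hom_comp_apply, hom_comp_apply, leftPartialTrace_apply, leftPartialTrace_apply, map_sum]
  refine Finset.sum_congr rfl fun i _ => ?_
  change contract U'.V _ (TensorProduct.map LinearMap.id b.hom (f.hom (_ ⊗ₜ[k] a.hom u))) = _
  exact contract_map _ _ _

variable [Module.Finite k A]

/-- The linear form on the endomorphisms of the regular module given by a linear form on `A`. -/
def regularForm (τ : A →ₗ[k] k) : (regular k A ⟶ regular k A) →ₗ[k] k where
  toFun f := τ (f.hom (1 : A))
  map_add' _ _ := map_add τ _ _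
  map_smul' _ _ := map_smul τ _ _

theorem regularForm_apply (τ : A →ₗ[k] k) (f : regular k A ⟶ regular k A) :
    regularForm τ f = τ (f.hom (1 : A)) := rfl

theorem regularForm_comm {τ : A →ₗ[k] k} (hτ : ∀ a b, τ (a * b) = τ (b * a))
    (f h : regular k A ⟶ regular k A) : regularForm τ (f ≫ h) = regularForm τ (h ≫ f) := by
  -- Evaluation at `1` identifies `End(A)` with right multiplications, so cyclicity is the symmetry
  -- of `τ`.
  have key : ∀ (f h : regular k A ⟶ regular k A),
      (f ≫ h).hom (1 : A) = (f.hom (1 : A) : A) * (h.hom (1 : A) : A) := by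
    intro f h
    have h₁ := hom_apply_ρ h (f.hom (1 : A)) (1 : A)
    have h₂ : (regular k A).ρ (f.hom (1 : A)) (1 : A) = f.hom (1 : A) := mul_one (M := A) _
    rw [h₂] at h₁
    exact h₁
  rw [regularForm_apply, regularForm_apply, key, key, hτ]

/-- On `w ⊗ a` the left side is `φ(S⁻¹(a₁) w) τ(a₂)`, and the hypothesis replaces `τ(a₂) a₁` by
`τ(a) g`. The resulting `g⁻¹` is exactly the one in `coevR`. -/
theorem form_freeCoord_tensorLeftInv (g : Pivot k A) {τ : A →ₗ[k] k}
    (hτ : ∀ a, ∑ i ∈ (ℛ k a).index, τ ((ℛ k a).right i) • (ℛ k a).left i = τ a • (g.val : A))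
    (W : FDMod k A) (φ : W.V →ₗ[k] k) (z : W.V ⊗[k] A) :
    τ ((freeCoord φ).hom (tensorLeftInv g W z)) =
      τ (contract A (φ ∘ₗ W.ρ ((g.val⁻¹ : Aˣ) : A)) z) := by
  induction z with
  | zero => simp
  | add x y hx hy => simp only [map_add, hx, hy]
  | tmul w a =>
    have h := congrArg (fun b => φ (W.ρ (g.antipodeInv b) w)) (hτ a)
    have h₁ : g.antipodeInv (g.val : A) = ((g.val⁻¹ : Aˣ) : A) := by
      simp [g.antipodeInv_apply, g.antipode_val]
    simp only [map_sum, map_smul, LinearMap.sum_apply, LinearMap.smul_apply, h₁, smul_eq_mul] at h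
    rw [tensorLeftInv_tmul, map_sum, map_sum]
    change ∑ i ∈ _, τ (φ _ • (ℛ k a).right i) = τ (φ _ • a)
    simp only [map_smul, smul_eq_mul]
    rw [mul_comm _ (τ a), ← h]
    exact Finset.sum_congr rfl fun i _ => mul_comm _ _

theorem extendTrace_isLeftMTrace (g : Pivot k A) {τ : A →ₗ[k] k}
    (hτ : ∀ a b, τ (a * b) = τ (b * a))
    (hτ' : ∀ a, ∑ i ∈ (ℛ k a).index, τ ((ℛ k a).right i) • (ℛ k a).left i = τ a • (g.val : A)) :
    (extendTrace (regular_isIdealGenerator (k := k) (A := A))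
      (regularForm τ)).IsLeftMTrace (pivotal g) where
  cyclic := extendTrace_isCyclic _ (regularForm_comm hτ)
  left_partial U W (hU : Projective U) hWU f := by
    have hcyc := extendTrace_isCyclic (regular_isIdealGenerator (k := k) (A := A))
      (regularForm_comm hτ)
    -- The case `U = A` suffices: the partial trace commutes with morphisms in `U`, and the identity
    -- of `U` is a sum through `A`.
    have hreg : ∀ (hW : isProjective (FDMod k A) (W ⊗ regular k A))
        (f : W ⊗ regular k A ⟶ W ⊗ regular k A),
        extendTrace (regular_isIdealGenerator (k := k) (A := A)) (regularForm τ) _ hW f =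
          regularForm τ (leftPartialTrace (pivotal g) f) := by
      intro hW f
      obtain ⟨e, he, he'⟩ := exists_iso_tensor_regular g W
      let b := Module.finBasis k W.V
      -- With `X(v) = (id ⊗ τ)(f(v ⊗ 1))`, both sides are the ordinary trace of `X` composed with
      -- `g⁻¹`, up to the order of the factors and the basis used.
      let X : W.V →ₗ[k] W.V := (TensorProduct.rid k W.V).toLinearMap ∘ₗ τ.lTensor W.V ∘ₗ
        f.hom ∘ₗ (TensorProduct.mk k W.V A).flip 1
      have hX : ∀ (φ : W.V →ₗ[k] k) (v : W.V), τ (contract A φ (f.hom (v ⊗ₜ[k] (1 : A)))) =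
          LinearMap.lcomp k k X φ v := fun φ v => form_contract φ τ _
      rw [extendTrace_eq _ (regularForm_comm hτ) hW (iso_free_id_eq_sum e b), regularForm_apply,
        leftPartialTrace_apply, map_sum]
      refine Eq.trans ?_ (((Module.Basis.ofVectorSpace k W.V).sum_coord_eq_sum_coord b
        (LinearMap.lcomp k k (X ∘ₗ W.ρ ((g.val⁻¹ : Aˣ) : A)))).symm.trans
        (Finset.sum_congr rfl fun i _ => (hX _ _).symm))
      refine Eq.trans ?_ (b.sum_coord_comp (LinearMap.lcomp k k X) (W.ρ ((g.val⁻¹ : Aˣ) : A)))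
      refine Finset.sum_congr rfl fun i _ => ?_
      rw [← hX, ← form_freeCoord_tensorLeftInv g hτ', ← he']
      have h₁ : (freeIncl (b i) ≫ e.hom).hom (1 : A) = b i ⊗ₜ[k] (1 : A) := by
        rw [hom_comp_apply, freeIncl_apply, he, freeLift_tmul, ρ_one]
        rfl
      rw [← h₁]
      rfl
    obtain ⟨n, a, b, h⟩ := exists_id_eq_sum_of_projective U
    have hW : isProjective (FDMod k A) (W ⊗ regular k A) := tensor_regular_projective g W
    rw [extendTrace_eq _ (regularForm_comm hτ) hU h]
    have h₁ : f = ∑ j, (f ≫ W ◁ b j) ≫ W ◁ a j := by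
      conv_lhs => rw [← Category.comp_id f, ← whiskerLeft_id, h, whiskerLeft_sum]
      simp [Preadditive.comp_sum]
    conv_lhs => rw [h₁, map_sum]
    refine Finset.sum_congr rfl fun j _ => ?_
    rw [hcyc _ _ hW hWU, hreg hW, leftPartialTrace_whiskerLeft]

end FDMod

end LeftTrace

/-! ### Non-degeneracy, the dual-basis sum, and the chromatic identity. -/

noncomputable section Chromatic

namespace FDMod

open Coalgebra HopfAlgebra

variable {k A : Type u} [Field k] [Ring A] [HopfAlgebra k A]

variable (k A) in
/-- The linear map `(p ⊗ φ) ⊗ (q ⊗ r) ↦ φ(q) p ⊗ r`. -/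
def middleContract : (A ⊗[k] Module.Dual k A) ⊗[k] (A ⊗[k] A) →ₗ[k] A ⊗[k] A :=
  ((TensorProduct.lid k A).toLinearMap ∘ₗ (contractLeft k A).rTensor A ∘ₗ
    (TensorProduct.assoc k (Module.Dual k A) A A).symm.toLinearMap).lTensor A ∘ₗ
    (TensorProduct.assoc k A (Module.Dual k A) (A ⊗[k] A)).toLinearMap

theorem middleContract_tmul (p q r : A) (φ : Module.Dual k A) :
    middleContract k A ((p ⊗ₜ[k] φ) ⊗ₜ[k] (q ⊗ₜ[k] r)) = φ q • (p ⊗ₜ[k] r) := by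
  change p ⊗ₜ[k] (φ q • r) = _
  rw [TensorProduct.tmul_smul]

/-- Contracting the dual bases gives `l(S(x₁) u x₂)`; the Nakayama property moves `x₂` to the front
as `S²(x₂)`, where `S²(x₂) S(x₁) = S(x₁ S(x₂))` collapses to `ε(x)`. -/
theorem sum_integral_contract {l : A →ₗ[k] k} {c : A} (h : IsIntegralPair l c) (g : Pivot k A)
    (hA : IsUnimodular k A) {ι : Type*} [Fintype ι] (b : Module.Basis ι k A) (u x : A) :
    ∑ i, ∑ j ∈ (ℛ k x).index, l (antipode k ((ℛ k x).left j) * b i) *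
      b.coord i (u * (ℛ k x).right j) = counit (R := k) x * l u := by
  rw [Finset.sum_comm]
  have h₁ : ∀ j, ∑ i, l (antipode k ((ℛ k x).left j) * b i) * b.coord i (u * (ℛ k x).right j) =
      l (antipode k ((ℛ k x).left j * antipode k ((ℛ k x).right j)) * u) := by
    intro j
    have h₂ := b.sum_coord_smul_map (l ∘ₗ LinearMap.mulLeft k (antipode k ((ℛ k x).left j)))
      (u * (ℛ k x).right j)
    rw [antipode_mul_antidistrib, mul_assoc, h.antipode_antipode_mul g hA, mul_assoc]
    refine Eq.trans (Finset.sum_congr rfl fun i _ => ?_) h₂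
    exact mul_comm _ _
  simp only [h₁]
  rw [← map_sum, ← Finset.sum_mul, ← map_sum, sum_mul_antipode_eq_smul, map_smul, antipode_one,
    smul_mul_assoc, one_mul, map_smul, smul_eq_mul]

variable [Module.Finite k A]

theorem exists_eq_smul_counitHom (y : regular k A ⟶ 𝟙_ (FDMod k A)) :
    ∃ r : k, y = r • counitHom k A := by
  refine ⟨y.hom (1 : A), hom_ext (LinearMap.ext fun (a : A) => ?_)⟩
  have h := hom_apply_ρ y a (1 : A)
  have h₁ : (regular k A).ρ a (1 : A) = a := mul_one a
  rw [h₁] at h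
  refine h.trans ?_
  exact mul_comm (G := k) _ _

theorem exists_eq_smul_cointegralHom {l : A →ₗ[k] k} {c : A} (h : IsIntegralPair l c)
    (g : Pivot k A) (hA : IsUnimodular k A) (x : 𝟙_ (FDMod k A) ⟶ regular k A) :
    ∃ r : k, x = r • cointegralHom c h.isLeftCointegral := by
  have hx : IsLeftCointegral k (x.hom (1 : k) : A) := by
    intro a
    have h₁ := hom_apply_ρ x a (1 : k)
    have h₂ : (𝟙_ (FDMod k A)).ρ a (1 : k) = counit (R := k) a • (1 : k) := rfl
    rw [h₂, map_smul] at h₁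
    exact h₁.symm
  refine ⟨l (x.hom (1 : k)), hom_ext (LinearMap.ext_ring ?_)⟩
  refine (h.eq_smul g hA hx).trans ?_
  change _ = l (x.hom (1 : k)) • ((1 : k) • c)
  rw [one_smul]

section Normalized

variable {t : TraceFamily k (isProjective (FDMod k A))} {l : A →ₗ[k] k} {c : A}

/-- By cyclicity everything is tested on `A`, where the morphisms to and from the unit are multiples
of `ε` and `Λ`; the normalization reads off the scalar. -/
theorem isNondegenerate_of_isCyclic (ht : t.IsCyclic) (h : IsIntegralPair l c)
    (g : Pivot k A) (hA : IsUnimodular k A)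
    (hP : isProjective (FDMod k A) (regular k A))
    (hn : t (regular k A) hP (counitHom k A ≫ cointegralHom c h.isLeftCointegral) = 1) :
    t.IsNondegenerate := by
  intro P (hP' : Projective P)
  obtain ⟨n, f, q, e⟩ := exists_id_eq_sum_of_projective P
  refine ⟨fun x hx => ?_, fun y hy => ?_⟩
  · have h₁ : ∀ j, x ≫ q j = 0 := by
      intro j
      obtain ⟨r, hr⟩ := exists_eq_smul_cointegralHom h g hA (x ≫ q j)
      have h₂ := hx (q j ≫ counitHom k A)
      rw [Category.assoc, ht _ _ hP hP', Category.assoc, hr, Linear.comp_smul, map_smul, hn] at h₂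
      have h₃ : r = 0 := by simpa using h₂
      rw [hr, h₃, zero_smul]
    rw [← Category.comp_id x, e, Preadditive.comp_sum]
    exact Finset.sum_eq_zero fun j _ => by rw [← Category.assoc, h₁, Limits.zero_comp]
  · have h₁ : ∀ j, f j ≫ y = 0 := by
      intro j
      obtain ⟨r, hr⟩ := exists_eq_smul_counitHom (f j ≫ y)
      have h₂ := hy (cointegralHom c h.isLeftCointegral ≫ f j)
      rw [← Category.assoc, ht _ _ hP hP', ← Category.assoc, hr, Linear.smul_comp, map_smul,
        hn] at h₂
      have h₃ : r = 0 := by simpa using h₂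
      rw [hr, h₃, zero_smul]
    rw [← Category.id_comp y, e, Preadditive.sum_comp]
    simp [h₁]

/-- On a free module the dual bases are the copies of `Λ` and `ε` on the summands: cyclicity brings
their pairing back to `A`, and the normalization makes it the Kronecker delta. -/
theorem isDualBasisSum_of_iso_free (ht : t.IsCyclic) (h : IsIntegralPair l c)
    (g : Pivot k A) (hA : IsUnimodular k A)
    (hP : isProjective (FDMod k A) (regular k A))
    (hn : t (regular k A) hP (counitHom k A ≫ cointegralHom c h.isLeftCointegral) = 1)
    {V : Type u} [AddCommGroup V] [Module k V] [Module.Finite k V]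
    {M : FDMod k A} (e : free k A V ≅ M) {n : ℕ} (b : Module.Basis (Fin n) k V)
    (hM : isProjective (FDMod k A) M) :
    t.IsDualBasisSum M hM (∑ i, ((e.inv ≫ freeCoord (b.coord i)) ≫ counitHom k A) ≫
      cointegralHom c h.isLeftCointegral ≫ freeIncl (b i) ≫ e.hom) := by
  let x (i : Fin n) : 𝟙_ (FDMod k A) ⟶ M :=
    cointegralHom c h.isLeftCointegral ≫ freeIncl (b i) ≫ e.hom
  let y (i : Fin n) : M ⟶ 𝟙_ (FDMod k A) := (e.inv ≫ freeCoord (b.coord i)) ≫ counitHom k A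
  have hxy : ∀ i j, t M hM (y j ≫ x i) = if i = j then 1 else 0 := by
    intro i j
    have h₁ : y j ≫ x i = (e.inv ≫ freeCoord (b.coord j)) ≫
      ((counitHom k A ≫ cointegralHom c h.isLeftCointegral) ≫ freeIncl (b i) ≫ e.hom) := by
      simp only [x, y, Category.assoc]
    rw [h₁, ht _ _ hP hM, Category.assoc, iso_free_incl_coord]
    split_ifs
    · rw [Category.comp_id, hn]
    · simp
  have hid := iso_free_id_eq_sum e b
  have hx : LinearIndependent k x := by
    rw [Fintype.linearIndependent_iff]
    intro r hr j
    have h₁ := congrArg (fun z => t M hM (y j ≫ z)) hr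
    simpa [Preadditive.comp_sum, hxy] using h₁
  have hy : LinearIndependent k y := by
    rw [Fintype.linearIndependent_iff]
    intro r hr j
    have h₁ := congrArg (fun z => t M hM (z ≫ x j)) hr
    simpa [Preadditive.sum_comp, hxy] using h₁
  have hx' : ⊤ ≤ Submodule.span k (Set.range x) := by
    intro z _
    rw [← Category.comp_id z, hid, Preadditive.comp_sum]
    refine Submodule.sum_mem _ fun i _ => ?_
    obtain ⟨r, hr⟩ := exists_eq_smul_cointegralHom h g hA (z ≫ e.inv ≫ freeCoord (b.coord i))
    rw [← Category.assoc, hr, Linear.smul_comp]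
    exact Submodule.smul_mem _ _ (Submodule.subset_span ⟨i, rfl⟩)
  have hy' : ⊤ ≤ Submodule.span k (Set.range y) := by
    intro z _
    rw [← Category.id_comp z, hid, Preadditive.sum_comp]
    refine Submodule.sum_mem _ fun i _ => ?_
    obtain ⟨r, hr⟩ := exists_eq_smul_counitHom ((freeIncl (b i) ≫ e.hom) ≫ z)
    rw [Category.assoc, hr, Linear.comp_smul]
    exact Submodule.smul_mem _ _ (Submodule.subset_span ⟨i, rfl⟩)
  refine ⟨n, Module.Basis.mk hx hx', Module.Basis.mk hy hy', fun i j => ?_, ?_⟩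
  · rw [Module.Basis.mk_apply, Module.Basis.mk_apply, hxy]
  · simp only [Module.Basis.mk_apply]
    rfl

end Normalized

/-- In the free coordinates `a ⊗ m` becomes `a₁ ⊗ S(a₂) m`; the counit leaves `S(a) m`, and
reinserting `c` gives `c · (1 ⊗ S(a) m)`. -/
theorem sum_coord_counit_cointegral {c : A} (hc : IsLeftCointegral k c) (M : FDMod k A)
    {e : free k A M.V ≅ regular k A ⊗ M}
    (he : e.hom = freeLift (M := regular k A ⊗ M) (TensorProduct.mk k A M.V 1))
    (he' : ∀ x, e.inv.hom x = tensorRightInv M x) {n : ℕ} (b : Module.Basis (Fin n) k M.V)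
    (a : A) (m : M.V) :
    (∑ i, ((e.inv ≫ freeCoord (b.coord i)) ≫ counitHom k A) ≫ cointegralHom c hc ≫
      freeIncl (b i) ≫ e.hom : regular k A ⊗ M ⟶ regular k A ⊗ M).hom (a ⊗ₜ[k] m) =
      ∑ i ∈ (ℛ k c).index, (ℛ k c).left i ⊗ₜ[k]
        M.ρ ((ℛ k c).right i) (M.ρ (antipode k a) m) := by
  have h₁ : ∀ φ : M.V →ₗ[k] k, (counitHom k A).hom ((freeCoord φ).hom (e.inv.hom (a ⊗ₜ[k] m))) =
      φ (M.ρ (antipode k a) m) := by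
    intro φ
    rw [he', tensorRightInv_tmul, map_sum, map_sum]
    have h₂ := congrArg (fun z => φ (M.ρ (antipode k z) m)) (sum_counit_smul (ℛ k a))
    simp only [map_sum, map_smul, LinearMap.sum_apply, LinearMap.smul_apply] at h₂
    refine Eq.trans (Finset.sum_congr rfl fun i _ => ?_) h₂
    rw [freeCoord_tmul, map_smul]
    exact mul_comm _ _
  have h₂ : ∀ i, (freeIncl (b i) ≫ e.hom).hom c =
      (tensor (regular k A) M).ρ c ((1 : A) ⊗ₜ[k] b i) := by
    intro i
    rw [hom_comp_apply, freeIncl_apply, he, freeLift_tmul]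
    rfl
  let F : M.V →ₗ[k] A ⊗[k] M.V :=
    (tensor (regular k A) M).ρ c ∘ₗ TensorProduct.mk k A M.V 1
  have h₃ := b.sum_coord_smul_map F (M.ρ (antipode k a) m)
  rw [sum_hom, LinearMap.sum_apply]
  refine Eq.trans (Finset.sum_congr rfl fun i _ => ?_) (h₃.trans ?_)
  · change (freeIncl (b i) ≫ e.hom).hom
      ((counitHom k A).hom ((freeCoord (b.coord i)).hom (e.inv.hom (a ⊗ₜ[k] m))) • c) = _
    rw [h₁, map_smul, h₂]
    rfl
  · refine (tensor_ρ_repr (regular k A) M c (1 : A) _).trans ?_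
    refine Finset.sum_congr rfl fun i _ => ?_
    change ((ℛ k c).left i * 1) ⊗ₜ[k] _ = _
    rw [mul_one]

theorem dTilde_apply (g : Pivot k A) (l : A →ₗ[k] k) (y x : A) :
    (dTilde g l).hom (y ⊗ₜ[k] x) = ∑ i ∈ (ℛ k x).index, ∑ j ∈ (ℛ k ((ℛ k x).left i)).index,
      l (antipode k ((ℛ k ((ℛ k x).left i)).left j) * ((g.val : A) * y)) •
        ((ℛ k ((ℛ k x).left i)).right j ⊗ₜ[k] (ℛ k x).right i) := by
  let F : (Module.Dual k A ⊗[k] A) ⊗[k] A →ₗ[k] A ⊗[k] A :=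
    (TensorProduct.lid k (A ⊗[k] A)).toLinearMap ∘ₗ
      TensorProduct.map ((evR g (regular k A)).hom) LinearMap.id ∘ₗ
      (TensorProduct.assoc k A (Module.Dual k A) (A ⊗[k] A)).symm.toLinearMap ∘ₗ
      TensorProduct.mk k A _ y ∘ₗ (TensorProduct.assoc k (Module.Dual k A) A A).toLinearMap
  have hF : ∀ (φ : Module.Dual k A) (p q : A),
      F ((φ ⊗ₜ[k] p) ⊗ₜ[k] q) = φ ((g.val : A) * y) • (p ⊗ₜ[k] q) := fun _ _ _ => rfl
  change F (TensorProduct.map (integralHom l).hom LinearMap.id (comul (R := k) x)) = _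
  rw [← (ℛ k x).eq, map_sum, map_sum]
  refine Finset.sum_congr rfl fun i _ => ?_
  have h : (integralHom l).hom ((ℛ k x).left i) =
      ∑ j ∈ (ℛ k ((ℛ k x).left i)).index,
        (dual (regular k A)).ρ ((ℛ k ((ℛ k x).left i)).left j) l ⊗ₜ[k]
          (ℛ k ((ℛ k x).left i)).right j := by
    refine (tensor_ρ_repr (dual (regular k A)) (regular k A) _ l (1 : A)).trans ?_
    refine Finset.sum_congr rfl fun j _ => ?_
    refine congrArg (_ ⊗ₜ[k] ·) ?_
    exact mul_one (M := A) _
  rw [TensorProduct.map_tmul, h, TensorProduct.sum_tmul, map_sum]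
  exact Finset.sum_congr rfl fun j _ => hF _ _ _

theorem chromaticComposite_apply (g : Pivot k A)
    (L : regular k A ⊗ dual (regular k A) ⟶ regular k A ⊗ dual (regular k A))
    (d : regular k A ⊗ regular k A ⟶ regular k A ⊗ regular k A) (a x : A) :
    (chromaticComposite (pivotal g) L d).hom (a ⊗ₜ[k] x) = ∑ i, middleContract k A
      (L.hom (a ⊗ₜ[k] (Module.Basis.ofVectorSpace k A).coord i) ⊗ₜ[k]
        d.hom ((((g.val⁻¹ : Aˣ) : A) * Module.Basis.ofVectorSpace k A i) ⊗ₜ[k] x)) := by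
  change middleContract k A (TensorProduct.map L.hom d.hom
    ((TensorProduct.assoc k A (Module.Dual k A) (A ⊗[k] A)).symm (a ⊗ₜ[k]
      (TensorProduct.assoc k (Module.Dual k A) A A
        ((TensorProduct.comm k A (Module.Dual k A)
          (TensorProduct.map ((regular k A).ρ ((g.val⁻¹ : Aˣ) : A)) LinearMap.id
            (coevaluation k A 1))) ⊗ₜ[k] x))))) = _
  rw [coevaluation_apply_one]
  simp only [TensorProduct.sum_tmul, map_sum, TensorProduct.assoc_tmul, TensorProduct.comm_tmul,
    TensorProduct.map_tmul, LinearMap.id_apply, TensorProduct.tmul_sum,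
    TensorProduct.assoc_symm_tmul]
  rfl

theorem chromaticComposite_dTilde {l : A →ₗ[k] k} {c : A} (h : IsIntegralPair l c)
    (g : Pivot k A) (hA : IsUnimodular k A)
    (L : regular k A ⊗ dual (regular k A) ⟶ regular k A ⊗ dual (regular k A))
    (hL : ∀ (a : A) (φ : Module.Dual k A), L.hom (a ⊗ₜ[k] φ) = ∑ i ∈ (ℛ k c).index,
      (ℛ k c).left i ⊗ₜ[k] (dual (regular k A)).ρ ((ℛ k c).right i)
        ((dual (regular k A)).ρ (antipode k a) φ)) :
    chromaticComposite (pivotal g) L (dTilde g l) = 𝟙 (regular k A ⊗ regular k A) := by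
  refine hom_ext (TensorProduct.ext' fun (a : A) (x : A) => ?_)
  rw [chromaticComposite_apply]
  let b := Module.Basis.ofVectorSpace k A
  have h₁ : ∀ i, middleContract k A (L.hom (a ⊗ₜ[k] b.coord i) ⊗ₜ[k]
      (dTilde g l).hom ((((g.val⁻¹ : Aˣ) : A) * b i) ⊗ₜ[k] x)) =
      ∑ m ∈ (ℛ k c).index, ∑ n ∈ (ℛ k x).index, ∑ j ∈ (ℛ k ((ℛ k x).left n)).index,
        (l (antipode k ((ℛ k ((ℛ k x).left n)).left j) * b i) *
          b.coord i (antipode k (antipode k a) * antipode k ((ℛ k c).right m) *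
            (ℛ k ((ℛ k x).left n)).right j)) • ((ℛ k c).left m ⊗ₜ[k] (ℛ k x).right n) := by
    intro i
    -- The pivot from `evR` in `dTilde` cancels the inverse pivot from `coevR` in the composite.
    rw [hL, dTilde_apply, Units.mul_inv_cancel_left]
    simp only [TensorProduct.sum_tmul, TensorProduct.tmul_sum, map_sum, TensorProduct.tmul_smul,
      map_smul, middleContract_tmul]
    simp only [Finset.smul_sum, smul_smul]
    rw [Finset.sum_congr rfl fun n _ => Finset.sum_comm, Finset.sum_comm]
    refine Finset.sum_congr rfl fun m _ => Finset.sum_congr rfl fun n _ =>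
      Finset.sum_congr rfl fun j _ => ?_
    rw [mul_assoc (antipode k (antipode k a))]
    rfl
  rw [Finset.sum_congr rfl fun i _ => h₁ i, Finset.sum_comm]
  -- `sum_integral_contract` is used with `u = S²(a) S(c₂)`; the Nakayama property then turns
  -- `l(S²(a) S(c₂))` into `l(S(c₂) a)`, and the sum over `m` below restores `a`.
  have h₂ : ∀ m, ∑ i, ∑ n ∈ (ℛ k x).index, ∑ j ∈ (ℛ k ((ℛ k x).left n)).index,
        (l (antipode k ((ℛ k ((ℛ k x).left n)).left j) * b i) *
          b.coord i (antipode k (antipode k a) * antipode k ((ℛ k c).right m) *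
            (ℛ k ((ℛ k x).left n)).right j)) • ((ℛ k c).left m ⊗ₜ[k] (ℛ k x).right n) =
      (l (antipode k ((ℛ k c).right m) * a) • (ℛ k c).left m) ⊗ₜ[k] x := by
    intro m
    rw [Finset.sum_comm]
    simp only [← Finset.sum_smul, sum_integral_contract h g hA b, h.antipode_antipode_mul g hA]
    conv_rhs => rw [← sum_counit_smul (ℛ k x)]
    simp only [TensorProduct.tmul_sum, TensorProduct.tmul_smul, TensorProduct.smul_tmul', mul_smul]
  simp only [h₂]
  rw [← TensorProduct.sum_tmul, h.sum_smul_left g hA]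
  rfl

theorem isChromatic_dTilde {t : TraceFamily k (isProjective (FDMod k A))} {l : A →ₗ[k] k} {c : A}
    (ht : t.IsCyclic) (h : IsIntegralPair l c) (g : Pivot k A) (hA : IsUnimodular k A)
    (hP : isProjective (FDMod k A) (regular k A))
    (hn : t (regular k A) hP (counitHom k A ≫ cointegralHom c h.isLeftCointegral) = 1) :
    t.IsChromatic (pivotal g) (dTilde g l) := by
  obtain ⟨e, he, he'⟩ := exists_iso_regular_tensor (dual (regular k A))
  have hM : isProjective (FDMod k A) (regular k A ⊗ dual (regular k A)) :=
    projective_of_iso_free e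
  refine ⟨hP, hM, _, isDualBasisSum_of_iso_free ht h g hA hP hn e
    (Module.finBasis k (dual (regular k A)).V) hM, ?_⟩
  exact chromaticComposite_dTilde h g hA _ (sum_coord_counit_cointegral _ _ he he' _)

end FDMod

end Chromatic

/-! ### Assembly of the four assertions. -/

theorem mainTheorem5 (k A : Type u) [Field k] [Ring A] [HopfAlgebra k A] [Module.Finite k A]
    (g : Pivot k A) (hA : IsUnimodular k A) (hg : IsUnibalanced g) :
    IsTensorIdeal (isProjective (FDMod k A)) ∧
    IsIdealGenerator (isProjective (FDMod k A)) (FDMod.regular k A) ∧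
    (∃ (l : A →ₗ[k] k) (c : A), IsRightIntegral l ∧ IsLeftCointegral k c ∧ l c = 1) ∧
    ∃ hP : isProjective (FDMod k A) (FDMod.regular k A),
      ∀ (l : A →ₗ[k] k) (c : A) (hc : IsLeftCointegral k c), IsRightIntegral l → l c = 1 →
        (∃ t : TraceFamily k (isProjective (FDMod k A)),
          t.IsMTrace (FDMod.pivotal g) ∧ t.IsNondegenerate ∧
            t (FDMod.regular k A) hP (FDMod.counitHom k A ≫ FDMod.cointegralHom c hc) = 1) ∧
        ∀ t : TraceFamily k (isProjective (FDMod k A)),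
          t.IsMTrace (FDMod.pivotal g) → t.IsNondegenerate →
            t (FDMod.regular k A) hP (FDMod.counitHom k A ≫ FDMod.cointegralHom c hc) = 1 →
            t.IsChromatic (FDMod.pivotal g) (FDMod.dTilde g l) := by
  refine ⟨FDMod.isTensorIdeal_isProjective g, FDMod.regular_isIdealGenerator, ?_,
    FDMod.regular_projective, fun l c hc hl hlc => ?_⟩
  · obtain ⟨l, c, h⟩ := exists_isIntegralPair g
    exact ⟨l, c, h.isRightIntegral, h.isLeftCointegral, h.apply_eq_one⟩
  · have h : IsIntegralPair l c := ⟨hl, hc, hlc⟩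
    have hτ := h.symmetrizedIntegral_mul_comm g hA
    have hleft := FDMod.extendTrace_isLeftMTrace g hτ (hl.sum_symmetrizedIntegral g)
    have hn : extendTrace FDMod.regular_isIdealGenerator
        (FDMod.regularForm (symmetrizedIntegral g l)) (FDMod.regular k A) FDMod.regular_projective
        (FDMod.counitHom k A ≫ FDMod.cointegralHom c hc) = 1 := by
      rw [extendTrace_generator _ (FDMod.regularForm_comm hτ), FDMod.regularForm_apply]
      change symmetrizedIntegral g l (Coalgebra.counit (R := k) (1 : A) • c) = 1
      rw [Bialgebra.counit_one, one_smul, h.symmetrizedIntegral_cointegral g hA]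
    -- Only the left partial trace property has been computed; the right one is the unibalanced
    -- hypothesis `hg`.
    exact ⟨⟨_, ⟨hleft, hg _ hleft⟩,
      FDMod.isNondegenerate_of_isCyclic hleft.cyclic h g hA _ hn, hn⟩,
      fun t ht _ hn => FDMod.isChromatic_dTilde ht.1.cyclic h g hA _ hn⟩
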